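/- Let $\Gamma=(\mathcal G,\mathfrak E)$ be a finite undirected simple graph, write $i\sim j$ for adjacent vertices, and let $\Lambda\subset\mathcal G$. Let $U_j:\mathbb R\to\mathbb R$ ($j\in\mathcal G$), $V_{ij}:\mathbb R\to\mathbb R$ ($i\sim j$) with $V_{ij}(x)=V_{ji}(-x)$, and $\kappa_m:\mathbb R\to\mathbb R$ ($m\in\Lambda$) be functions, and let $r\ge 0$ be an integer. Assume the following. (A1) The functions $U_j$ and $V_{ij}$ are $C^\infty$, and each $V_{ij}''$ has only isolated zeros. (A2) For each $m\in\Lambda$: $\kappa_m$ is $C^2$; $\kappa_m(\nu)=0$ if and only if $\nu=0$; $\kappa_m,\kappa_m''\in L^1(\mathbb R)\cap L^2(\mathbb R)$; and $\nu^r\kappa_m,\ |\nu|^{r/2}\kappa_m'\in L^2(\mathbb R)$. Put $K_m=\int_{\mathbb R}\kappa_m(\nu)^2\nu^{-2}\,d\nu$ (finite by (A2)) and define the effective potential on $\mathbb R^{\mathcal G}$ by $$V^{\rm eff}(q)=\sum_{j\in\mathcal G}U_j(q_j)+\frac12\sum_{i,j\in\mathcal G:\,i\sim j}V_{ij}(q_i-q_j)-\sum_{m\in\Lambda}\frac{K_mq_m^2}{2}.$$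 (A3) $V^{\rm eff}(q)\to+\infty$ as $|q|\to\infty$. (A4) The initial data $(q_0,\dot q_0)\in\mathbb R^{\mathcal G}\times\mathbb R^{\mathcal G}$ and $\xi_{0m},\dot\xi_{0m}:\mathbb R\to\mathbb R$ (measurable) satisfy $\frac12\int_{\mathbb R}\big(\dot\xi_{0m}(\nu)^2+\nu^2\xi_{0m}(\nu)^2\big)\,d\nu<\infty$ for every $m\in\Lambda$. (A5) Let $\Lambda_\Gamma$ be the set obtained from $\Lambda$ by iterating the following step until nothing changes: given the current set $S$, add to $S$ every vertex $n\notin S$ for which there is $j\in S$ such that $n$ is the unique vertex outside $S$ adjacent to $j$. Then $\Lambda_\Gamma=\mathcal G$. Let $q(t)=(q_j(t))_{j\in\mathcal G}$ and $\xi_m(\nu,t)$, $t\in\mathbb R$, be a solution, defined for all times, of $$\ddot q_j=-U_j'(q_j)+\sum_{i\sim j}V_{ij}'(q_i-q_j)+\mathbf 1_{j\in\Lambda}\int_{\mathbb R}\kappa_j(\nu)\xi_j(\nu,t)\,d\nu,\qquad j\in\mathcal G,$$ $$\ddot\xi_m(\nu,t)=-\nu^2\xi_m(\nu,t)+\kappa_m(\nu)q_m(t),\qquad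 m\in\Lambda,\ \text{a.e. }\nu\in\mathbb R,$$ with initial conditions $(q,\xi,\dot q,\dot\xi)(0)=(q_0,\xi_0,\dot q_0,\dot\xi_0)$. Let $\mathcal N^{\rm eff}=\{q\in\mathbb R^{\mathcal G}:\partial_{q_j}V^{\rm eff}(q)=0\ \ \forall j\in\mathcal G\}$. Then there are connected components $\mathcal N^{\rm eff}_+$ and $\mathcal N^{\rm eff}_-$ of $\mathcal N^{\rm eff}$ such that, for the Euclidean distance, $$\operatorname{dist}\big(q(t),\mathcal N^{\rm eff}_\pm\big)\to 0\quad\text{as } t\to\pm\infty.$$ Moreover, $q$ is $C^{r+3}$-smooth and, for every $1\le l\le r+3$, its time derivative satisfies $q^{(l)}(t)\to 0$ both as $t\to+\infty$ and as $t\to-\infty$. -/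

import Mathlib

open Filter Topology MeasureTheory
open scoped ENNReal

/-- The data of a network of one-dimensional oscillators placed at the vertices of a finite
undirected graph, some of which (those in `Λ`) are coupled to their own thermostats.
`U j` is the pinning potential of the oscillator `j`, `V i j` the interaction potential of adjacent
oscillators, and `κ m` the coupling function of the thermostat attached to `m ∈ Λ`.
The values of `V i j` for non-adjacent `i, j` and of `κ m` for `m ∉ Λ` play no role. -/
structure OscillatorNetwork (𝒢 : Type*) where
  graph : SimpleGraph 𝒢
  Λ : Finset 𝒢
  U : 𝒢 → ℝ → ℝ
  V : 𝒢 → 𝒢 → ℝ → ℝ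
  κ : 𝒢 → ℝ → ℝ
  V_symm : ∀ i j, graph.Adj i j → ∀ x, V i j x = V j i (-x)

/-- One round of the controllability procedure: to a set `S` of vertices one adds every vertex `n`
outside `S` which is, for some `j ∈ S`, the unique vertex outside `S` adjacent to `j`. -/
def controlStep {𝒢 : Type*} (G : SimpleGraph 𝒢) (S : Set 𝒢) : Set 𝒢 :=
  S ∪ {n | ∃ j ∈ S, (n ∉ S ∧ G.Adj j n) ∧ ∀ k, k ∉ S ∧ G.Adj j k → k = n}

/-- The set `Λ_Γ` obtained from `S` by iterating `controlStep`. The iterates increase, so on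
a finite graph they stabilize, and the union is the set at which the procedure stops. -/
def controlClosure {𝒢 : Type*} (G : SimpleGraph 𝒢) (S : Set 𝒢) : Set 𝒢 :=
  ⋃ k : ℕ, (controlStep G)^[k] S

/-- The energy `(1/2) ∫ ξ̇(ν)² + ν² ξ(ν)² dν` of a thermostat with coordinates `ξ` and
velocities `ξ'`, as an element of `[0, ∞]`. -/
noncomputable def thermostatEnergy (ξ ξ' : ℝ → ℝ) : ℝ≥0∞ :=
  ∫⁻ ν : ℝ, ENNReal.ofReal ((ξ' ν ^ 2 + ν ^ 2 * ξ ν ^ 2) / 2)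

namespace OscillatorNetwork

variable {𝒢 : Type*} [Fintype 𝒢] (S : OscillatorNetwork 𝒢)

/-- The constant `K_m = ∫ κ_m(ν)² / ν² dν` (a convergent integral when `κ_m` is a `C²` function
in `L²` with `κ_m(0) = 0`). -/
noncomputable def K (m : 𝒢) : ℝ := ∫ ν : ℝ, S.κ m ν ^ 2 / ν ^ 2

open scoped Classical in
/-- The effective potential
`∑_j U_j(q_j) + (1/2) ∑_{i ∼ j} V_ij(q_i - q_j) - ∑_{m ∈ Λ} K_m q_m² / 2`, where the second sum is
over ordered pairs of adjacent vertices. -/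
noncomputable def Veff (q : EuclideanSpace ℝ 𝒢) : ℝ :=
  ∑ j, S.U j (q j)
    + (1 / 2) * ∑ i, ∑ j, (if S.graph.Adj i j then S.V i j (q i - q j) else 0)
    - ∑ m ∈ S.Λ, S.K m * q m ^ 2 / 2

open scoped Classical in
/-- The set of critical points of the effective potential: all partial derivatives vanish. -/
def criticalSet : Set (EuclideanSpace ℝ 𝒢) :=
  {q | ∀ j, lineDeriv ℝ S.Veff q (EuclideanSpace.single j 1) = 0}

/-- The potentials are smooth, and the second derivatives of the interaction potentials have only
isolated zeros. -/
def SmoothPotentials {𝒢 : Type*} (S : OscillatorNetwork 𝒢) : Prop :=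
  (∀ j, ContDiff ℝ ((⊤ : ℕ∞) : WithTop ℕ∞) (S.U j)) ∧
  ∀ i j, S.graph.Adj i j → ContDiff ℝ ((⊤ : ℕ∞) : WithTop ℕ∞) (S.V i j) ∧
    ∀ x, deriv (deriv (S.V i j)) x = 0 → ∀ᶠ y in 𝓝[≠] x, deriv (deriv (S.V i j)) y ≠ 0

/-- The assumptions on the coupling functions, with the integer `r ≥ 0`: each `κ_m` is `C²`,
vanishes exactly at `0`, satisfies `κ_m, κ_m'' ∈ L¹ ∩ L²` and `ν^r κ_m, |ν|^{r/2} κ_m' ∈ L²`. -/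
def CouplingCondition {𝒢 : Type*} (S : OscillatorNetwork 𝒢) (r : ℕ) : Prop :=
  ∀ m ∈ S.Λ,
    ContDiff ℝ 2 (S.κ m) ∧
    (∀ ν, S.κ m ν = 0 ↔ ν = 0) ∧
    MemLp (S.κ m) 1 volume ∧ MemLp (S.κ m) 2 volume ∧
    MemLp (deriv (deriv (S.κ m))) 1 volume ∧ MemLp (deriv (deriv (S.κ m))) 2 volume ∧
    MemLp (fun ν : ℝ => ν ^ r * S.κ m ν) 2 volume ∧
    MemLp (fun ν : ℝ => |ν| ^ ((r : ℝ) / 2) * deriv (S.κ m) ν) 2 volume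

/-- The effective potential tends to `+∞` as `|q| → ∞`. -/
def Coercive : Prop :=
  Tendsto S.Veff (Bornology.cobounded (EuclideanSpace ℝ 𝒢)) atTop

/-- The initial coordinates `ξ₀ m` and velocities `ξ₀' m` of every thermostat `m ∈ Λ` are
measurable functions of the frequency, and have finite energy. -/
def FiniteThermostatEnergy {𝒢 : Type*} (S : OscillatorNetwork 𝒢) (ξ₀ ξ₀' : 𝒢 → ℝ → ℝ) : Prop :=
  ∀ m ∈ S.Λ, AEMeasurable (ξ₀ m) volume ∧ AEMeasurable (ξ₀' m) volume ∧
    thermostatEnergy (ξ₀ m) (ξ₀' m) < ⊤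

/-- The vertices of `Λ` control the whole graph: `Λ_Γ` is the set of all vertices. -/
def Controllable {𝒢 : Type*} (S : OscillatorNetwork 𝒢) : Prop :=
  controlClosure S.graph (S.Λ : Set 𝒢) = Set.univ

open scoped Classical in
/-- `(q, ξ)`, defined for all times, solves
`q̈_j = -U_j'(q_j) + ∑_{i ∼ j} V_ij'(q_i - q_j) + 1_{j ∈ Λ} ∫ κ_j(ν) ξ_j(ν, t) dν` and
`ξ̈_m(ν) = -ν² ξ_m(ν) + κ_m(ν) q_m` for `m ∈ Λ`, with `(q, ξ, q̇, ξ̇)(0) = (q₀, ξ₀, q₀', ξ₀')`.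
Here `ξ m ν t` stands for `ξ_m(ν, t)`; the thermostat equations and initial conditions
are only required for almost every frequency `ν`, and time derivatives are classical.
Integrability of `κ_m ξ_m(·, t)` is not listed, as it is a consequence: the thermostat equation
determines `ξ_m` from `q_m` and the initial data, and if these have finite energy and `κ_m, κ_m / ν`
are in `L²` then `ν ξ_m(ν, t)` is square integrable in `ν`. -/
structure IsSolution (q₀ q₀' : EuclideanSpace ℝ 𝒢) (ξ₀ ξ₀' : 𝒢 → ℝ → ℝ)
    (q : ℝ → EuclideanSpace ℝ 𝒢) (ξ : 𝒢 → ℝ → ℝ → ℝ) : Prop where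
  differentiable_q : ∀ j, Differentiable ℝ (fun s => q s j)
  eq_q : ∀ j t, HasDerivAt (deriv (fun s => q s j))
    (-deriv (S.U j) (q t j)
      + ∑ i, (if S.graph.Adj i j then deriv (S.V i j) (q t i - q t j) else 0)
      + (if j ∈ S.Λ then ∫ ν : ℝ, S.κ j ν * ξ j ν t else 0)) t
  eq_ξ : ∀ m ∈ S.Λ, ∀ᵐ ν : ℝ, Differentiable ℝ (ξ m ν) ∧
    ∀ t, HasDerivAt (deriv (ξ m ν)) (-ν ^ 2 * ξ m ν t + S.κ m ν * q t m) t
  init_q : q 0 = q₀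
  init_q' : ∀ j, deriv (fun s => q s j) 0 = q₀' j
  init_ξ : ∀ m ∈ S.Λ, ∀ᵐ ν : ℝ, ξ m ν 0 = ξ₀ m ν
  init_ξ' : ∀ m ∈ S.Λ, ∀ᵐ ν : ℝ, deriv (ξ m ν) 0 = ξ₀' m ν

end OscillatorNetwork

/-!
The argument reduces the infinite-dimensional system to a forced equation for the network alone,
and shows that the force disappears at large times.

For a thermostat with coupling `κ`, attached to a vertex with coordinate `q`, the complex
amplitude `z(ν, t) = ξ̇ + i (νξ - κ q / ν)` satisfies `ż = iνz - i k q̇` with `k = κ / ν`, which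
is in `L²`. In these terms the network obeys `q̈_j = -∂_j V^eff(q) + R_j`, where
`R_j = Im ∫ k z dν` for thermostated vertices and `R_j = 0` for the others
(`IsSolution.hasDerivAt_velocity`), and
`(1/2) |q̇|² + V^eff(q) + (1/2) ∑_m ∫ |z_m|² dν` is conserved (`IsSolution.energy_conserved`). By
coercivity the positions, the velocities and the energies of the thermostats stay bounded.

Up to phases, `k(ν) ∫ exp (-iνs) q̇(s) ds`, the integral being over a time interval, is the
increment of the amplitude over this interval, so it is bounded in `L²` uniformly in the interval.
Since `k` vanishes at most at the origin, Plancherel's formula shows that every frequency band of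
`q̇` away from `0` and `∞` is square integrable in time and hence tends to zero
(`tendsto_schwartz_convolution`). The remaining high frequencies are small because `q̇` is
Lipschitz, the low ones because `q` is bounded. Thus `q̇_m → 0` at the thermostated vertices
(`tendsto_zero_of_weighted_fourier_bounded`). Then the amplitudes `z_m` tend to zero weakly in
`L²` (`tendsto_bathPairing`): this holds when they are tested against functions `s / k` with `s`
smooth and supported away from the origin, and these are dense. In particular `R_j → 0`.

Rest propagates through the graph by Barbalat's lemma. If `q̇_j → 0`, then `∂_j V^eff(q) → 0`; if
only one neighbour `n` of `j` is not yet known to come to rest, then differentiating gives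
`V_nj''(q_n - q_j) (q̇_n - q̇_j) → 0`, and since `V_nj''` has isolated zeros, `q̇_n → 0`
(`tendsto_velocity_of_neighbours`). By controllability all velocities and all `∂_j V^eff(q)` tend
to zero, so the limit set of `q`, which is connected, consists of critical points
(`exists_connectedComponentIn_tendsto_infDist`).

The derivatives of `∫ ν^i k z dν` are, up to multiples of `q̇`, pairings of the same kind with `i`
increased by one, and `ν^i k` is in `L²` for `i ≤ r + 1`. Hence each use of the equation of motion
raises the number of decaying derivatives, up to `r + 3` for `q`. Negative times follow by time
reversal.
-/

/-! ### Asymptotics of functions with controlled derivatives -/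

/-- A form of Barbalat's lemma: if the increments of `f` over every fixed step tend to zero, and
`f'` is the sum of a Lipschitz function `g` and a function tending to zero, then `g` tends to
zero. -/
theorem tendsto_zero_of_increments {f g h : ℝ → ℝ} {L : ℝ}
    (hf : ∀ t, HasDerivAt f (g t + h t) t) (hg : ∀ s t, |g s - g t| ≤ L * |s - t|)
    (hh : Tendsto h atTop (𝓝 0))
    (hinc : ∀ τ > 0, Tendsto (fun t => f (t + τ) - f t) atTop (𝓝 0)) :
    Tendsto g atTop (𝓝 0) := by
  rw [Metric.tendsto_atTop]
  intro ε hε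
  have hL : 0 ≤ L := by
    have := hg 1 0
    have h2 := abs_nonneg (g 1 - g 0)
    simp at this
    linarith
  set τ := ε / (4 * (L + 1)) with hτ
  have hτpos : 0 < τ := by positivity
  have hLτ : L * τ ≤ ε / 4 := by
    rw [hτ, mul_div_assoc', div_le_div_iff₀ (by positivity) (by norm_num)]
    nlinarith
  obtain ⟨T1, hT1⟩ := (Metric.tendsto_atTop.1 hh) (ε / 4) (by positivity)
  obtain ⟨T2, hT2⟩ := (Metric.tendsto_atTop.1 (hinc τ hτpos)) (τ * (ε / 4)) (by positivity)
  refine ⟨max T1 T2, fun t ht => ?_⟩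
  obtain ⟨c, hc, hceq⟩ := exists_hasDerivAt_eq_slope f (fun t => g t + h t)
    (show t < t + τ by linarith) (fun x _ => (hf x).continuousAt.continuousWithinAt)
    (fun x _ => hf x)
  have h1 := hT1 c (by have := le_max_left T1 T2; linarith [hc.1])
  have h2 := hT2 t (by have := le_max_right T1 T2; linarith)
  rw [Real.dist_eq, sub_zero] at h1 h2 ⊢
  have h3 : |g c + h c| < ε / 4 := by
    rw [hceq, abs_div, show t + τ - t = τ by ring, abs_of_pos hτpos, div_lt_iff₀ hτpos]
    linarith
  have h4 := hg c t
  have h5 : |c - t| ≤ τ := by rw [abs_le]; constructor <;> linarith [hc.1, hc.2]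
  have h6 : L * |c - t| ≤ L * τ := by gcongr
  rw [abs_lt] at h1 h3 ⊢
  rw [abs_le] at h4
  constructor <;> linarith [h1.1, h1.2, h3.1, h3.2, h4.1, h4.2]

theorem tendsto_increment_zero_of_tendsto_zero {f : ℝ → ℝ} (hf : Tendsto f atTop (𝓝 0)) (τ : ℝ) :
    Tendsto (fun t => f (t + τ) - f t) atTop (𝓝 0) := by
  simpa using (hf.comp (tendsto_atTop_add_const_right atTop τ tendsto_id)).sub hf

theorem tendsto_increment_zero_of_deriv {f f' : ℝ → ℝ} (hf : ∀ t, HasDerivAt f (f' t) t)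
    (hf' : Tendsto f' atTop (𝓝 0)) {τ : ℝ} (hτ : 0 < τ) :
    Tendsto (fun t => f (t + τ) - f t) atTop (𝓝 0) := by
  rw [Metric.tendsto_atTop]
  intro ε hε
  obtain ⟨T, hT⟩ := (Metric.tendsto_atTop.1 hf') (ε / τ) (by positivity)
  refine ⟨T, fun t ht => ?_⟩
  obtain ⟨c, hc, hceq⟩ := exists_hasDerivAt_eq_slope f f'
    (show t < t + τ by linarith) (fun x _ => (hf x).continuousAt.continuousWithinAt)
    (fun x _ => hf x)
  have h1 := hT c (by linarith [hc.1])
  rw [Real.dist_eq, sub_zero] at h1 ⊢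
  rwa [hceq, abs_div, show t + τ - t = τ by ring, abs_of_pos hτ,
    div_lt_div_iff_of_pos_right hτ] at h1

theorem lipschitz_bound_of_deriv_bound {E : Type*} [NormedAddCommGroup E] [NormedSpace ℝ E]
    {f f' : ℝ → E} {C : ℝ} (hf : ∀ t, HasDerivAt f (f' t) t)
    (hC : ∀ t, ‖f' t‖ ≤ C) (s t : ℝ) : ‖f s - f t‖ ≤ C * |s - t| := by
  simpa using Convex.norm_image_sub_le_of_norm_hasDerivWithin_le
    (fun x _ => (hf x).hasDerivWithinAt) (fun x _ => hC x) convex_univ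
    (Set.mem_univ t) (Set.mem_univ s)

/-- A bounded function `x` with Lipschitz velocity `y` such that `W(x) y → 0`, where `W` has only
isolated zeros, has `y → 0`: the primitive `Φ` of `|W|` is strictly increasing and
`Φ(x)' = |W(x)| y → 0`, so the increments of `Φ(x)`, hence those of `x`, tend to zero. -/
theorem tendsto_zero_of_mul_isolated_zeros {W : ℝ → ℝ} (hW : Continuous W)
    (hiso : ∀ x, W x = 0 → ∀ᶠ y in 𝓝[≠] x, W y ≠ 0) {x y : ℝ → ℝ} {M L : ℝ}
    (hx : ∀ t, HasDerivAt x (y t) t) (hM : ∀ t, |x t| ≤ M)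
    (hy : ∀ s t, |y s - y t| ≤ L * |s - t|)
    (hWy : Tendsto (fun t => W (x t) * y t) atTop (𝓝 0)) : Tendsto y atTop (𝓝 0) := by
  set Φ : ℝ → ℝ := fun x => ∫ u in (0:ℝ)..x, |W u| with hΦ
  have hΦd : ∀ x, HasDerivAt Φ |W x| x := fun x =>
    intervalIntegral.integral_hasDerivAt_right (hW.abs.intervalIntegrable _ _)
      hW.abs.aestronglyMeasurable.stronglyMeasurableAtFilter hW.abs.continuousAt
  have hΦc : Continuous Φ := continuous_iff_continuousAt.2 fun x => (hΦd x).continuousAt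
  have hΦm : StrictMono Φ := by
    intro a b hab
    have h1 : Φ b - Φ a = ∫ u in a..b, |W u| :=
      intervalIntegral.integral_interval_sub_left (hW.abs.intervalIntegrable _ _)
        (hW.abs.intervalIntegrable _ _)
    have h2 : 0 < ∫ u in a..b, |W u| := by
      refine intervalIntegral.integral_pos hab hW.abs.continuousOn (fun _ _ => abs_nonneg _) ?_
      by_cases ha : W a = 0
      · have h3 : ∀ᶠ y in 𝓝[>] a, W y ≠ 0 :=
          (hiso a ha).filter_mono (nhdsWithin_mono _ fun y hy => ne_of_gt hy)
        obtain ⟨c, hc1, hc2⟩ := (h3.and (Ioc_mem_nhdsGT hab)).exists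
        exact ⟨c, ⟨hc2.1.le, hc2.2⟩, abs_pos.2 hc1⟩
      · exact ⟨a, ⟨le_rfl, hab.le⟩, abs_pos.2 ha⟩
    linarith
  have hcomp : ∀ t, HasDerivAt (fun t => Φ (x t)) (|W (x t)| * y t) t := fun t =>
    (hΦd (x t)).comp t (hx t)
  have habs : Tendsto (fun t => |W (x t)| * y t) atTop (𝓝 0) := by
    rw [tendsto_zero_iff_abs_tendsto_zero] at hWy ⊢
    refine hWy.congr fun t => ?_
    simp [abs_mul]
  refine tendsto_zero_of_increments (f := x) (g := y) (h := fun _ => 0) (by simpa using hx) hy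
    tendsto_const_nhds fun τ hτ => ?_
  have hinc := tendsto_increment_zero_of_deriv hcomp habs hτ
  rw [Metric.tendsto_atTop]
  intro ε hε
  have hM0 : 0 ≤ M := (abs_nonneg _).trans (hM 0)
  obtain ⟨a, ha, hamin⟩ := (isCompact_Icc (a := -M) (b := M)).exists_isMinOn
    ⟨0, by constructor <;> linarith⟩
    (f := fun a => Φ (a + ε) - Φ a)
    ((hΦc.comp (continuous_id.add continuous_const)).sub hΦc).continuousOn
  have hδ : 0 < Φ (a + ε) - Φ a := sub_pos.2 (hΦm (by linarith))
  obtain ⟨T, hT⟩ := (Metric.tendsto_atTop.1 hinc) _ hδ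
  refine ⟨T, fun t ht => ?_⟩
  have h1 := hT t ht
  rw [Real.dist_eq, sub_zero] at h1 ⊢
  by_contra! hcon
  have key : ∀ u v, |u| ≤ M → ε ≤ v - u → Φ (a + ε) - Φ a ≤ Φ v - Φ u := by
    intro u v hu huv
    have h2 : Φ (a + ε) - Φ a ≤ Φ (u + ε) - Φ u := hamin (abs_le.1 hu)
    have h3 : Φ (u + ε) ≤ Φ v := hΦm.monotone (by linarith)
    linarith
  rcases le_abs.1 hcon with h | h
  · have := key _ _ (hM t) h
    linarith [le_abs_self (Φ (x (t + τ)) - Φ (x t))]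
  · have := key (x (t + τ)) (x t) (hM _) (by linarith)
    linarith [neg_le_abs (Φ (x (t + τ)) - Φ (x t))]

/-! ### Limit sets of bounded curves -/

/-- A bounded continuous curve on whose cluster points a continuous family of functions vanishes
approaches a single connected component of the set of common zeros. -/
theorem exists_connectedComponentIn_tendsto_infDist {E : Type*} [NormedAddCommGroup E]
    [ProperSpace E] {q : ℝ → E} (hq : Continuous q) {M : ℝ} (hM : ∀ t, ‖q t‖ ≤ M) {N : Set E}
    (hN : ∀ x, MapClusterPt x atTop q → x ∈ N) :
    ∃ c ∈ N, Tendsto (fun t => Metric.infDist (q t) (connectedComponentIn N c)) atTop (𝓝 0) := by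
  set Ω : Set E := {x | MapClusterPt x atTop q} with hΩ
  have hK : IsCompact (Metric.closedBall (0 : E) M) := isCompact_closedBall _ _
  have hqK : ∀ t, q t ∈ Metric.closedBall (0 : E) M := fun t => by simpa using hM t
  have hΩclosed : IsClosed Ω := isClosed_setOfPred_clusterPt
  have hΩK : Ω ⊆ Metric.closedBall (0 : E) M := fun x hx =>
    hK.isClosed.mem_of_mapClusterPt hx (Eventually.of_forall hqK)
  have hΩcompact : IsCompact Ω := hK.of_isClosed_subset hΩclosed hΩK
  have cluster : ∀ s : Set ℝ, (∃ᶠ t in atTop, t ∈ s) →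
      ∃ x, MapClusterPt x (atTop ⊓ 𝓟 s) q := by
    intro s hs
    have : NeBot (atTop ⊓ 𝓟 s) := frequently_mem_iff_neBot.1 hs
    obtain ⟨x, _, hx⟩ := hK.exists_mapClusterPt (f := atTop ⊓ 𝓟 s) (u := q)
      (le_principal_iff.2 (mem_map.2 (Eventually.of_forall hqK)))
    exact ⟨x, hx⟩
  obtain ⟨c, hc⟩ := cluster Set.univ (Eventually.frequently (by simp))
  have hcΩ : c ∈ Ω := hc.mono inf_le_left
  -- A partition of the limit set into two closed parts would be crossed infinitely often at
  -- points equidistant from both parts, which would accumulate outside the limit set.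
  have hconn : IsPreconnected Ω := by
    rw [isPreconnected_iff_subset_of_fully_disjoint_closed hΩclosed]
    intro u v hu hv huv hdisj
    by_contra! hcon
    obtain ⟨hnu, hnv⟩ := hcon
    obtain ⟨b, hbΩ, hbu⟩ := Set.not_subset.1 hnu
    obtain ⟨a, haΩ, hav⟩ := Set.not_subset.1 hnv
    have hau : a ∈ u := (huv haΩ).resolve_right hav
    have hbv : b ∈ v := (huv hbΩ).resolve_left hbu
    set d : E → ℝ := fun x => Metric.infDist x u - Metric.infDist x v with hd
    have hdc : Continuous d := (Metric.continuous_infDist_pt u).sub (Metric.continuous_infDist_pt v)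
    have hda : d a < 0 := by
      have h1 : Metric.infDist a u = 0 := Metric.infDist_zero_of_mem hau
      have h2 : 0 < Metric.infDist a v := (hv.notMem_iff_infDist_pos ⟨b, hbv⟩).1 hav
      simp only [hd]; linarith
    have hdb : 0 < d b := by
      have h1 : Metric.infDist b v = 0 := Metric.infDist_zero_of_mem hbv
      have h2 : 0 < Metric.infDist b u := (hu.notMem_iff_infDist_pos ⟨a, hau⟩).1 hbu
      simp only [hd]; linarith
    have hfa : ∃ᶠ t in atTop, d (q t) < 0 :=
      (mapClusterPt_iff_frequently.1 haΩ) _ (hdc.continuousAt.eventually_lt_const hda)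
    have hfb : ∃ᶠ t in atTop, 0 < d (q t) :=
      (mapClusterPt_iff_frequently.1 hbΩ) _ (hdc.continuousAt.eventually_const_lt hdb)
    have hf0 : ∃ᶠ t in atTop, t ∈ {t | d (q t) = 0} := by
      rw [frequently_atTop]
      intro T
      obtain ⟨t1, ht1, h1⟩ := (frequently_atTop.1 hfa) T
      obtain ⟨t2, ht2, h2⟩ := (frequently_atTop.1 hfb) t1
      obtain ⟨s, hs, hs0⟩ := intermediate_value_Icc ht2 (hdc.comp hq).continuousOn
        (show (0:ℝ) ∈ Set.Icc _ _ from ⟨h1.le, h2.le⟩)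
      exact ⟨s, ht1.trans hs.1, hs0⟩
    obtain ⟨x, hx⟩ := cluster _ hf0
    have hxΩ : x ∈ Ω := hx.mono inf_le_left
    have hx0 : d x = 0 := by
      have : IsClosed {x | d x = 0} := isClosed_eq hdc continuous_const
      exact this.mem_of_mapClusterPt hx (mem_inf_of_right (mem_principal_self _))
    rcases huv hxΩ with h | h
    · have h1 : Metric.infDist x u = 0 := Metric.infDist_zero_of_mem h
      have : x ∈ v := (hv.mem_iff_infDist_zero ⟨b, hbv⟩).2 (by simp only [hd] at hx0; linarith)
      exact Set.disjoint_left.1 hdisj h this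
    · have h1 : Metric.infDist x v = 0 := Metric.infDist_zero_of_mem h
      have : x ∈ u := (hu.mem_iff_infDist_zero ⟨a, hau⟩).2 (by simp only [hd] at hx0; linarith)
      exact Set.disjoint_left.1 hdisj this h
  refine ⟨c, hN c hcΩ, ?_⟩
  have hsub : Ω ⊆ connectedComponentIn N c :=
    hconn.subset_connectedComponentIn hcΩ fun x hx => hN x hx
  have hlim : Tendsto (fun t => Metric.infDist (q t) Ω) atTop (𝓝 0) := by
    rw [Metric.tendsto_atTop']
    by_contra! hcon
    obtain ⟨ε, hε, hcon⟩ := hcon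
    have hfr : ∃ᶠ t in atTop, t ∈ {t | ε ≤ Metric.infDist (q t) Ω} := by
      rw [frequently_atTop']
      intro T
      obtain ⟨t, ht, h⟩ := hcon T
      refine ⟨t, ht, ?_⟩
      rwa [Real.dist_eq, sub_zero, abs_of_nonneg Metric.infDist_nonneg] at h
    obtain ⟨x, hx⟩ := cluster _ hfr
    have h1 : ε ≤ Metric.infDist x Ω := by
      have : IsClosed {x | ε ≤ Metric.infDist x Ω} :=
        isClosed_le continuous_const (Metric.continuous_infDist_pt Ω)
      exact this.mem_of_mapClusterPt hx (mem_inf_of_right (mem_principal_self _))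
    have h2 : Metric.infDist x Ω = 0 := Metric.infDist_zero_of_mem (hx.mono inf_le_left)
    linarith
  exact squeeze_zero (fun _ => Metric.infDist_nonneg)
    (fun t => Metric.infDist_le_infDist_of_subset hsub ⟨c, hcΩ⟩) hlim

/-! ### Functions whose derivatives decay -/

section Decay

variable {E F : Type*} [NormedAddCommGroup E] [NormedSpace ℝ E]
  [NormedAddCommGroup F] [NormedSpace ℝ F]

/-- `f` is of class `C^n`, and `f` and its derivatives up to order `n` tend to zero at `+∞`. -/
def DecaysToOrder (n : ℕ) (f : ℝ → E) : Prop :=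
  ContDiff ℝ n f ∧ ∀ l ≤ n, Tendsto (iteratedDeriv l f) atTop (𝓝 0)

theorem decaysToOrder_zero {f : ℝ → E} :
    DecaysToOrder 0 f ↔ Continuous f ∧ Tendsto f atTop (𝓝 0) := by
  simp [DecaysToOrder, contDiff_zero]

theorem decaysToOrder_succ {n : ℕ} {f : ℝ → E} :
    DecaysToOrder (n + 1) f ↔
      Differentiable ℝ f ∧ Tendsto f atTop (𝓝 0) ∧ DecaysToOrder n (deriv f) := by
  have h1 : ContDiff ℝ ((n + 1 : ℕ) : WithTop ℕ∞) f ↔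
      Differentiable ℝ f ∧ ContDiff ℝ (n : WithTop ℕ∞) (deriv f) := by
    push_cast
    rw [contDiff_succ_iff_deriv]
    simp
  unfold DecaysToOrder
  rw [h1]
  constructor
  · rintro ⟨⟨h2, h3⟩, h4⟩
    refine ⟨h2, by simpa using h4 0 (by omega), h3, fun l hl => ?_⟩
    simpa [iteratedDeriv_succ'] using h4 (l + 1) (by omega)
  · rintro ⟨h2, h3, h4, h5⟩
    refine ⟨⟨h2, h4⟩, fun l hl => ?_⟩
    rcases l with _ | l
    · simpa using h3
    · simpa [iteratedDeriv_succ'] using h5 l (by omega)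

theorem DecaysToOrder.mono {m n : ℕ} {f : ℝ → E} (hf : DecaysToOrder n f) (h : m ≤ n) :
    DecaysToOrder m f :=
  ⟨hf.1.of_le (by exact_mod_cast h), fun l hl => hf.2 l (hl.trans h)⟩

theorem DecaysToOrder.tendsto {n : ℕ} {f : ℝ → E} (hf : DecaysToOrder n f) :
    Tendsto f atTop (𝓝 0) := by
  simpa using hf.2 0 (by omega)

theorem decaysToOrder_const_zero (n : ℕ) : DecaysToOrder n (fun _ : ℝ => (0 : E)) := by
  induction n with
  | zero => exact decaysToOrder_zero.2 ⟨continuous_const, tendsto_const_nhds⟩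
  | succ n ih =>
    refine decaysToOrder_succ.2 ⟨differentiable_const _, tendsto_const_nhds, ?_⟩
    rwa [deriv_const']

theorem DecaysToOrder.add {n : ℕ} {f g : ℝ → E} (hf : DecaysToOrder n f)
    (hg : DecaysToOrder n g) : DecaysToOrder n (fun t => f t + g t) := by
  refine ⟨hf.1.add hg.1, fun l hl => ?_⟩
  have : iteratedDeriv l (fun t => f t + g t) =
      fun t => iteratedDeriv l f t + iteratedDeriv l g t := by
    ext t
    exact iteratedDeriv_fun_add ((hf.1.of_le (by exact_mod_cast hl)).contDiffAt)
      ((hg.1.of_le (by exact_mod_cast hl)).contDiffAt)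
  rw [this]
  simpa using (hf.2 l hl).add (hg.2 l hl)

theorem DecaysToOrder.clm {n : ℕ} {f : ℝ → E} (hf : DecaysToOrder n f) (L : E →L[ℝ] F) :
    DecaysToOrder n (fun t => L (f t)) := by
  induction n generalizing f with
  | zero =>
    rw [decaysToOrder_zero] at hf ⊢
    refine ⟨L.continuous.comp hf.1, ?_⟩
    simpa [Function.comp_def] using (L.continuous.tendsto 0).comp hf.2
  | succ n ih =>
    rw [decaysToOrder_succ] at hf ⊢
    refine ⟨L.differentiable.comp hf.1, ?_, ?_⟩
    · simpa [Function.comp_def] using (L.continuous.tendsto 0).comp hf.2.1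
    have : deriv (fun t => L (f t)) = fun t => L (deriv f t) := by
      ext t
      exact (L.hasFDerivAt.comp_hasDerivAt t (hf.1 t).hasDerivAt).deriv
    rw [this]
    exact ih hf.2.2

theorem DecaysToOrder.neg {n : ℕ} {f : ℝ → E} (hf : DecaysToOrder n f) :
    DecaysToOrder n (fun t => - f t) := by
  simpa using hf.clm (-ContinuousLinearMap.id ℝ E)

theorem DecaysToOrder.sub {n : ℕ} {f g : ℝ → E} (hf : DecaysToOrder n f)
    (hg : DecaysToOrder n g) : DecaysToOrder n (fun t => f t - g t) := by
  simpa [sub_eq_add_neg] using hf.add hg.neg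

theorem DecaysToOrder.sum {n : ℕ} {ι : Type*} (s : Finset ι) {f : ι → ℝ → E}
    (hf : ∀ i ∈ s, DecaysToOrder n (f i)) : DecaysToOrder n (fun t => ∑ i ∈ s, f i t) := by
  classical
  induction s using Finset.induction_on with
  | empty => simpa using decaysToOrder_const_zero n
  | insert a s ha ih =>
    simp only [Finset.sum_insert ha]
    exact (hf a (by simp)).add (ih fun i hi => hf i (by simp [hi]))

/-- `f` is of class `C^n` and eventually bounded at `+∞`, and its derivatives of the orders from
`1` to `n` tend to zero at `+∞`. -/
def SlowToOrder (n : ℕ) (f : ℝ → ℝ) : Prop :=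
  ContDiff ℝ n f ∧ f =O[atTop] (fun _ => (1 : ℝ)) ∧
    ∀ l, 1 ≤ l → l ≤ n → Tendsto (iteratedDeriv l f) atTop (𝓝 0)

theorem slowToOrder_zero {f : ℝ → ℝ} :
    SlowToOrder 0 f ↔ Continuous f ∧ f =O[atTop] (fun _ => (1 : ℝ)) := by
  simp only [SlowToOrder, CharP.cast_eq_zero, contDiff_zero]
  constructor
  · exact fun h => ⟨h.1, h.2.1⟩
  · exact fun h => ⟨h.1, h.2, fun l h1 h2 => by omega⟩

theorem slowToOrder_succ {n : ℕ} {f : ℝ → ℝ} :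
    SlowToOrder (n + 1) f ↔
      Differentiable ℝ f ∧ f =O[atTop] (fun _ => (1 : ℝ)) ∧ DecaysToOrder n (deriv f) := by
  have h1 : ContDiff ℝ ((n + 1 : ℕ) : WithTop ℕ∞) f ↔
      Differentiable ℝ f ∧ ContDiff ℝ (n : WithTop ℕ∞) (deriv f) := by
    push_cast
    rw [contDiff_succ_iff_deriv]
    simp
  unfold SlowToOrder DecaysToOrder
  rw [h1]
  constructor
  · rintro ⟨⟨h2, h3⟩, h4, h5⟩
    refine ⟨h2, h4, h3, fun l hl => ?_⟩
    simpa [iteratedDeriv_succ'] using h5 (l + 1) (by omega) (by omega)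
  · rintro ⟨h2, h3, h4, h5⟩
    refine ⟨⟨h2, h4⟩, h3, fun l hl1 hl => ?_⟩
    obtain ⟨l, rfl⟩ := Nat.exists_eq_add_of_le' hl1
    simpa [iteratedDeriv_succ'] using h5 l (by omega)

theorem SlowToOrder.mono {m n : ℕ} {f : ℝ → ℝ} (hf : SlowToOrder n f) (h : m ≤ n) :
    SlowToOrder m f :=
  ⟨hf.1.of_le (by exact_mod_cast h), hf.2.1, fun l h1 hl => hf.2.2 l h1 (hl.trans h)⟩

theorem DecaysToOrder.slowToOrder {n : ℕ} {f : ℝ → ℝ} (hf : DecaysToOrder n f) :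
    SlowToOrder n f :=
  ⟨hf.1, hf.tendsto.isBigO_one ℝ, fun l _ hl => hf.2 l hl⟩

theorem SlowToOrder.sub {n : ℕ} {f g : ℝ → ℝ} (hf : SlowToOrder n f)
    (hg : SlowToOrder n g) : SlowToOrder n (fun t => f t - g t) := by
  rcases n with _ | n
  · rw [slowToOrder_zero] at *
    exact ⟨hf.1.sub hg.1, hf.2.sub hg.2⟩
  · rw [slowToOrder_succ] at *
    refine ⟨hf.1.sub hg.1, hf.2.1.sub hg.2.1, ?_⟩
    have : deriv (fun t => f t - g t) = fun t => deriv f t - deriv g t := by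
      ext t
      exact deriv_fun_sub (hf.1 t) (hg.1 t)
    rw [this]
    exact hf.2.2.sub hg.2.2

theorem SlowToOrder.add {n : ℕ} {f g : ℝ → ℝ} (hf : SlowToOrder n f)
    (hg : SlowToOrder n g) : SlowToOrder n (fun t => f t + g t) := by
  rcases n with _ | n
  · rw [slowToOrder_zero] at *
    exact ⟨hf.1.add hg.1, hf.2.add hg.2⟩
  · rw [slowToOrder_succ] at *
    refine ⟨hf.1.add hg.1, hf.2.1.add hg.2.1, ?_⟩
    have : deriv (fun t => f t + g t) = fun t => deriv f t + deriv g t := by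
      ext t
      exact deriv_fun_add (hf.1 t) (hg.1 t)
    rw [this]
    exact hf.2.2.add hg.2.2

theorem SlowToOrder.const (n : ℕ) (c : ℝ) : SlowToOrder n (fun _ => c) := by
  have h := Asymptotics.isBigO_const_const c (one_ne_zero (α := ℝ)) (atTop : Filter ℝ)
  rcases n with _ | n
  · exact slowToOrder_zero.2 ⟨continuous_const, h⟩
  · refine slowToOrder_succ.2 ⟨differentiable_const _, h, ?_⟩
    rw [deriv_const']
    exact decaysToOrder_const_zero n

theorem SlowToOrder.sum {n : ℕ} {ι : Type*} (s : Finset ι) {f : ι → ℝ → ℝ}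
    (hf : ∀ i ∈ s, SlowToOrder n (f i)) : SlowToOrder n (fun t => ∑ i ∈ s, f i t) := by
  classical
  induction s using Finset.induction_on with
  | empty => simpa using SlowToOrder.const n 0
  | insert a s ha ih =>
    simp only [Finset.sum_insert ha]
    exact (hf a (by simp)).add (ih fun i hi => hf i (by simp [hi]))

theorem SlowToOrder.mul_decays {n : ℕ} {f g : ℝ → ℝ} (hf : SlowToOrder n f)
    (hg : DecaysToOrder n g) : DecaysToOrder n (fun t => f t * g t) := by
  induction n generalizing f g with
  | zero =>
    rw [slowToOrder_zero] at hf
    rw [decaysToOrder_zero] at hg ⊢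
    refine ⟨hf.1.mul hg.1, ?_⟩
    have := hf.2.mul_isLittleO ((Asymptotics.isLittleO_one_iff ℝ).2 hg.2)
    simpa [Asymptotics.isLittleO_one_iff] using this
  | succ n ih =>
    have hf0 := hf.mono (Nat.le_succ n)
    have hg0 := hg.mono (Nat.le_succ n)
    have ht : DecaysToOrder 0 (fun t => f t * g t) := by
      have h1 := (ih hf0 hg0)
      exact h1.mono (Nat.zero_le _)
    rw [slowToOrder_succ] at hf
    rw [decaysToOrder_succ] at hg ⊢
    refine ⟨hf.1.mul hg.1, ht.tendsto, ?_⟩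
    have : deriv (fun t => f t * g t) = fun t => g t * deriv f t + f t * deriv g t := by
      ext t
      rw [deriv_fun_mul (hf.1 t) (hg.1 t)]
      ring
    rw [this]
    exact (ih hg0.slowToOrder hf.2.2).add (ih hf0 hg.2.2)

theorem isBigO_one_comp {α : Type*} {l : Filter α} {φ : ℝ → ℝ} {f : α → ℝ} (hφ : Continuous φ)
    (hf : f =O[l] (fun _ => (1 : ℝ))) : (fun t => φ (f t)) =O[l] (fun _ => (1 : ℝ)) := by
  obtain ⟨C, hC⟩ := hf.bound
  obtain ⟨B, hB⟩ := (isCompact_closedBall (0 : ℝ) C).exists_bound_of_continuousOn hφ.continuousOn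
  refine Asymptotics.IsBigO.of_bound B (hC.mono fun t ht => ?_)
  simp only [norm_one, mul_one] at ht ⊢
  exact hB _ (by simpa using ht)

theorem SlowToOrder.decaysToOrder {n : ℕ} {f : ℝ → ℝ} (hf : SlowToOrder n f)
    (h0 : Tendsto f atTop (𝓝 0)) : DecaysToOrder n f := by
  refine ⟨hf.1, fun l hl => ?_⟩
  rcases l with _ | l
  · simpa using h0
  · exact hf.2.2 _ (by omega) hl

theorem SlowToOrder.comp_smooth {n : ℕ} {f φ : ℝ → ℝ} (hf : SlowToOrder n f)
    (hφ : ContDiff ℝ ((⊤ : ℕ∞) : WithTop ℕ∞) φ) : SlowToOrder n (fun t => φ (f t)) := by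
  induction n generalizing φ with
  | zero =>
    rw [slowToOrder_zero] at *
    exact ⟨hφ.continuous.comp hf.1, isBigO_one_comp hφ.continuous hf.2⟩
  | succ n ih =>
    have hφ' := contDiff_infty_iff_deriv.1 hφ
    have h1 := ih (hf.mono (Nat.le_succ n)) hφ'.2
    rw [slowToOrder_succ] at *
    refine ⟨hφ'.1.comp hf.1, isBigO_one_comp hφ.continuous hf.2.1, ?_⟩
    have : deriv (fun t => φ (f t)) = fun t => deriv φ (f t) * deriv f t := by
      ext t
      exact ((hφ'.1 (f t)).hasDerivAt.comp t (hf.1 t).hasDerivAt).deriv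
    rw [this]
    exact h1.mul_decays hf.2.2

end Decay

/-! ### The modes of a thermostat -/

section Bath

open Complex

/-- The complex amplitude `exp (iνt) (z₀(ν) - i k(ν) ∫₀ᵗ exp (-iνs) v(s) ds)`, that is, the solution
of `ż = iνz - i k(ν) v(t)` with `z = z₀` at time `0`. For a thermostat with coupling `κ`, attached
to a coordinate `q`, this is `ξ̇ + i (νξ - κ q / ν)`, with `k = κ / ν` and `v = q̇`. -/
noncomputable def bathMode (k v : ℝ → ℝ) (z₀ : ℝ → ℂ) (t ν : ℝ) : ℂ :=
  exp (I * ν * t) * (z₀ ν - I * k ν * ∫ s in (0 : ℝ)..t, exp (-(I * ν * s)) * v s)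

/-- The pairing `∫ g(ν) z(ν, t) dν` of the amplitudes of a thermostat with a weight `g`. -/
noncomputable def bathPairing (k v : ℝ → ℝ) (z₀ : ℝ → ℂ) (g : ℝ → ℝ) (t : ℝ) : ℂ :=
  ∫ ν, (g ν : ℂ) * bathMode k v z₀ t ν

theorem norm_exp_I_mul_mul (ν t : ℝ) : ‖exp (I * ν * t)‖ = 1 := by
  rw [show I * (ν : ℂ) * t = I * ((ν * t : ℝ) : ℂ) by push_cast; ring]
  exact norm_exp_I_mul_ofReal _

theorem norm_exp_neg_I_mul_mul (ν t : ℝ) : ‖exp (-(I * ν * t))‖ = 1 := by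
  rw [show -(I * (ν : ℂ) * t) = I * ((-(ν * t) : ℝ) : ℂ) by push_cast; ring]
  exact norm_exp_I_mul_ofReal _

variable {k v : ℝ → ℝ} {z₀ : ℝ → ℂ}

theorem hasDerivAt_bathMode (hv : Continuous v) (t ν : ℝ) :
    HasDerivAt (fun t => bathMode k v z₀ t ν)
      (I * ν * bathMode k v z₀ t ν - I * k ν * v t) t := by
  have hc : Continuous fun s : ℝ => exp (-(I * ν * s)) * (v s : ℂ) := by fun_prop
  have h1 : HasDerivAt (fun t : ℝ => ∫ s in (0 : ℝ)..t, exp (-(I * ν * s)) * (v s : ℂ))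
      (exp (-(I * ν * t)) * v t) t :=
    intervalIntegral.integral_hasDerivAt_right (hc.intervalIntegrable _ _)
      hc.aestronglyMeasurable.stronglyMeasurableAtFilter hc.continuousAt
  have h2 : HasDerivAt (fun t : ℝ => exp (I * ν * t)) (exp (I * ν * t) * (I * ν)) t := by
    have h3 : HasDerivAt (fun t : ℝ => I * (ν : ℂ) * t) (I * ν) t := by
      simpa using (ofRealCLM.hasDerivAt (x := t)).const_mul (I * (ν : ℂ))
    exact h3.cexp
  have h4 := h2.mul ((h1.const_mul (I * (k ν : ℂ))).const_sub (z₀ ν))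
  refine h4.congr_deriv ?_
  have h5 : exp (I * ν * t) * exp (-(I * ν * t)) = 1 := by rw [← exp_add]; simp
  unfold bathMode
  linear_combination (-(I * k ν * v t)) * h5

theorem bathMode_zero (ν : ℝ) : bathMode k v z₀ 0 ν = z₀ ν := by simp [bathMode]

theorem continuous_bathMode (hv : Continuous v) (ν : ℝ) :
    Continuous fun t => bathMode k v z₀ t ν :=
  continuous_iff_continuousAt.2 fun t => (hasDerivAt_bathMode hv t ν).continuousAt

/-- The amplitudes are determined by their equation of motion. -/
theorem eq_bathMode (hv : Continuous v) {ν : ℝ} {z : ℝ → ℂ} (h0 : z 0 = z₀ ν)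
    (hz : ∀ t, HasDerivAt z (I * ν * z t - I * k ν * v t) t) (t : ℝ) :
    z t = bathMode k v z₀ t ν := by
  have h1 : ∀ t : ℝ, HasDerivAt (fun t : ℝ => exp (-(I * ν * t)))
      (exp (-(I * ν * t)) * (-(I * ν))) t := by
    intro t
    have h3 : HasDerivAt (fun t : ℝ => -(I * (ν : ℂ) * t)) (-(I * ν)) t := by
      simpa using ((ofRealCLM.hasDerivAt (x := t)).const_mul (I * (ν : ℂ))).fun_neg
    exact h3.cexp
  have h2 : ∀ t : ℝ,
      HasDerivAt (fun t : ℝ => exp (-(I * ν * t)) * (z t - bathMode k v z₀ t ν)) 0 t := by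
    intro t
    refine ((h1 t).mul ((hz t).fun_sub (hasDerivAt_bathMode hv t ν))).congr_deriv ?_
    ring
  have h3 := is_const_of_deriv_eq_zero (fun t => (h2 t).differentiableAt)
    (fun t => (h2 t).deriv) t 0
  simp only [h0, bathMode_zero, sub_self, mul_zero, mul_eq_zero, exp_ne_zero, false_or] at h3
  exact sub_eq_zero.1 h3

theorem bathMode_bound (hv : Continuous v) (T : ℝ) :
    ∃ B, 0 ≤ B ∧ ∀ t, |t| ≤ T → |v t| ≤ B ∧
      ∀ k z₀ ν, ‖bathMode k v z₀ t ν‖ ≤ ‖z₀ ν‖ + |k ν| * B := by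
  obtain ⟨Q, hQ⟩ := (isCompact_Icc (a := -T) (b := T)).exists_bound_of_continuousOn hv.continuousOn
  by_cases hT : 0 ≤ T
  swap
  · exact ⟨0, le_rfl, fun t ht => absurd ((abs_nonneg t).trans ht) hT⟩
  have hQ0 : 0 ≤ Q := (norm_nonneg _).trans (hQ 0 ⟨by linarith, hT⟩)
  refine ⟨max Q (Q * T), le_max_of_le_left hQ0, fun t ht => ⟨?_, fun k z₀ ν => ?_⟩⟩
  · exact (hQ t (abs_le.1 ht)).trans (le_max_left _ _)
  · have h1 : ‖∫ s in (0 : ℝ)..t, exp (-(I * ν * s)) * (v s : ℂ)‖ ≤ Q * |t - 0| := by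
      refine intervalIntegral.norm_integral_le_of_norm_le_const fun s hs => ?_
      rw [norm_mul, norm_exp_neg_I_mul_mul, one_mul, norm_real]
      refine hQ s (abs_le.1 ?_)
      rw [Set.uIoc, Set.mem_Ioc] at hs
      have h2 : -T ≤ min 0 t := le_min (by linarith) (abs_le.1 ht).1
      have h3 : max 0 t ≤ T := max_le hT (abs_le.1 ht).2
      exact abs_le.2 ⟨by linarith, by linarith⟩
    rw [sub_zero] at h1
    have h4 : Q * |t| ≤ max Q (Q * T) := le_max_of_le_right (by gcongr)
    rw [bathMode, norm_mul, norm_exp_I_mul_mul, one_mul]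
    refine (norm_sub_le _ _).trans ?_
    gcongr
    rw [norm_mul, norm_mul, norm_I, one_mul, norm_real, Real.norm_eq_abs]
    gcongr
    exact h1.trans h4

theorem continuous_freq_integral (hv : Continuous v) (a b : ℝ) :
    Continuous fun ν : ℝ => ∫ s in a..b, exp (-(I * ν * s)) * (v s : ℂ) :=
  intervalIntegral.continuous_parametric_intervalIntegral_of_continuous' (by fun_prop) _ _

theorem aestronglyMeasurable_bathMode (hv : Continuous v) (hk : AEStronglyMeasurable k volume)
    (hz : AEStronglyMeasurable z₀ volume) (t : ℝ) :
    AEStronglyMeasurable (bathMode k v z₀ t) volume := by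
  have h1 : Continuous fun ν : ℝ => exp (I * ν * t) := by fun_prop
  have h2 : AEStronglyMeasurable (fun ν => (k ν : ℂ)) volume :=
    continuous_ofReal.comp_aestronglyMeasurable hk
  exact h1.aestronglyMeasurable.mul (hz.sub ((h2.const_mul I).mul
    (continuous_freq_integral hv 0 t).aestronglyMeasurable))

theorem memLp_bathMode (hv : Continuous v) (hk : MemLp k 2) (hz : MemLp z₀ 2) (t : ℝ) :
    MemLp (bathMode k v z₀ t) 2 := by
  obtain ⟨B, hB0, hB⟩ := bathMode_bound hv |t|
  refine (hz.norm.add (hk.norm.mul_const B)).mono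
    (aestronglyMeasurable_bathMode hv hk.1 hz.1 t) (Eventually.of_forall fun ν => ?_)
  have h1 := (hB t le_rfl).2 k z₀ ν
  simp only [Pi.add_apply, Real.norm_eq_abs]
  exact h1.trans (le_abs_self _)

theorem integrable_mul_bathMode (hv : Continuous v) (hk : MemLp k 2) (hz : MemLp z₀ 2)
    {g : ℝ → ℝ} (hg : MemLp g 2) (t : ℝ) :
    Integrable fun ν => (g ν : ℂ) * bathMode k v z₀ t ν :=
  MemLp.integrable_mul (p := 2) (q := 2) hg.ofReal (memLp_bathMode hv hk hz t)

theorem continuous_bathPairing (hv : Continuous v) (hk : MemLp k 2) (hz : MemLp z₀ 2)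
    {g : ℝ → ℝ} (hg : MemLp g 2) : Continuous (bathPairing k v z₀ g) := by
  refine continuous_iff_continuousAt.2 fun t => ?_
  obtain ⟨B, hB0, hB⟩ := bathMode_bound hv (|t| + 1)
  refine continuousAt_of_dominated (bound := fun ν => |g ν| * (‖z₀ ν‖ + |k ν| * B)) ?_ ?_ ?_ ?_
  · exact Eventually.of_forall fun x => (integrable_mul_bathMode hv hk hz hg x).1
  · filter_upwards [Metric.ball_mem_nhds t one_pos] with x hx
    refine Eventually.of_forall fun ν => ?_
    rw [norm_mul, norm_real, Real.norm_eq_abs]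
    gcongr
    refine (hB x ?_).2 k z₀ ν
    rw [Metric.mem_ball, Real.dist_eq] at hx
    have := abs_add_le (x - t) t
    rw [sub_add_cancel] at this
    linarith
  · exact MemLp.integrable_mul (p := 2) (q := 2) hg.norm (hz.norm.add (hk.norm.mul_const B))
  · exact Eventually.of_forall fun ν =>
      ((continuous_bathMode hv ν).const_mul (g ν : ℂ)).continuousAt

theorem hasDerivAt_bathPairing (hv : Continuous v) (hk : MemLp k 2) (hz : MemLp z₀ 2)
    {g : ℝ → ℝ} (hg : MemLp g 2) (hg' : MemLp (fun ν => ν * g ν) 2) (t : ℝ) :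
    HasDerivAt (bathPairing k v z₀ g)
      (I * bathPairing k v z₀ (fun ν => ν * g ν) t - I * (∫ ν, g ν * k ν : ℝ) * v t) t := by
  obtain ⟨B, hB0, hB⟩ := bathMode_bound hv (|t| + 1)
  have hgk : Integrable fun ν => g ν * k ν := MemLp.integrable_mul (p := 2) (q := 2) hg hk
  have hgkC : Integrable fun ν => ((g ν * k ν : ℝ) : ℂ) := hgk.ofReal
  have hF' : ∀ ν, ∀ x, (g ν : ℂ) * (I * ν * bathMode k v z₀ x ν - I * k ν * v x) =
      I * ((ν * g ν : ℝ) * bathMode k v z₀ x ν) - I * (g ν * k ν : ℝ) * v x := by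
    intro ν x; push_cast; ring
  have hint : ∀ x, Integrable fun ν =>
      (g ν : ℂ) * (I * ν * bathMode k v z₀ x ν - I * k ν * v x) := by
    intro x
    simp_rw [hF']
    exact ((integrable_mul_bathMode hv hk hz hg' x).const_mul I).sub
      ((hgkC.const_mul I).mul_const _)
  have key := hasDerivAt_integral_of_dominated_loc_of_deriv_le (μ := volume)
    (F := fun t ν => (g ν : ℂ) * bathMode k v z₀ t ν)
    (F' := fun t ν => (g ν : ℂ) * (I * ν * bathMode k v z₀ t ν - I * k ν * v t))
    (bound := fun ν => |ν * g ν| * (‖z₀ ν‖ + |k ν| * B) + |g ν * k ν| * B)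
    (Metric.ball_mem_nhds t one_pos)
    (Eventually.of_forall fun x => (integrable_mul_bathMode hv hk hz hg x).1)
    (integrable_mul_bathMode hv hk hz hg t) (hint t).1 ?_ ?_ ?_
  · refine key.2.congr_deriv ?_
    simp_rw [hF']
    rw [integral_sub ((integrable_mul_bathMode hv hk hz hg' t).const_mul I)
      ((hgkC.const_mul I).mul_const _), integral_const_mul, integral_mul_const,
      integral_const_mul, integral_complex_ofReal]
    rfl
  · refine Eventually.of_forall fun ν x hx => ?_
    have hxt : |x| ≤ |t| + 1 := by
      rw [Metric.mem_ball, Real.dist_eq] at hx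
      have := abs_add_le (x - t) t
      rw [sub_add_cancel] at this
      linarith
    simp only [hF']
    refine (norm_sub_le _ _).trans ?_
    rw [norm_mul, norm_mul, norm_mul, norm_mul, norm_I, one_mul, one_mul, norm_real, norm_real,
      norm_real, Real.norm_eq_abs, Real.norm_eq_abs, Real.norm_eq_abs]
    gcongr
    · exact (hB x hxt).2 k z₀ ν
    · exact (hB x hxt).1
  · exact (MemLp.integrable_mul (p := 2) (q := 2) hg'.norm (hz.norm.add (hk.norm.mul_const B))).add
      (hgk.norm.mul_const B)
  · exact Eventually.of_forall fun ν x _ => (hasDerivAt_bathMode hv x ν).const_mul _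

/-- The rate of change of the energy of a thermostat is minus the power of the force
`Im ∫ k z dν` which it exerts. -/
theorem hasDerivAt_bathEnergy (hv : Continuous v) (hk : MemLp k 2) (hz : MemLp z₀ 2) (t : ℝ) :
    HasDerivAt (fun t => ∫ ν, ‖bathMode k v z₀ t ν‖ ^ 2)
      (-(2 * v t * (bathPairing k v z₀ k t).im)) t := by
  obtain ⟨B, hB0, hB⟩ := bathMode_bound hv (|t| + 1)
  have him : ∀ x, Integrable fun ν => k ν * (bathMode k v z₀ x ν).im := by
    intro x
    simpa using (integrable_mul_bathMode hv hk hz hk x).im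
  have key := hasDerivAt_integral_of_dominated_loc_of_deriv_le (μ := volume)
    (F := fun t ν => ‖bathMode k v z₀ t ν‖ ^ 2)
    (F' := fun t ν => -(2 * v t) * (k ν * (bathMode k v z₀ t ν).im))
    (bound := fun ν => (2 * B) * (|k ν| * (‖z₀ ν‖ + |k ν| * B)))
    (Metric.ball_mem_nhds t one_pos)
    (Eventually.of_forall fun x => ((memLp_bathMode hv hk hz x).norm.integrable_sq).1)
    (memLp_bathMode hv hk hz t).norm.integrable_sq ((him t).const_mul _).1 ?_ ?_ ?_
  · refine key.2.congr_deriv ?_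
    rw [integral_const_mul]
    have : (bathPairing k v z₀ k t).im = ∫ ν, k ν * (bathMode k v z₀ t ν).im := by
      have h := integral_im (integrable_mul_bathMode hv hk hz hk t)
      simp only [RCLike.im_to_complex] at h
      rw [bathPairing, ← h]
      simp
    rw [this]
    ring
  · refine Eventually.of_forall fun ν x hx => ?_
    have hxt : |x| ≤ |t| + 1 := by
      rw [Metric.mem_ball, Real.dist_eq] at hx
      have := abs_add_le (x - t) t
      rw [sub_add_cancel] at this
      linarith
    rw [norm_mul, norm_mul, norm_neg, norm_mul, Real.norm_eq_abs, Real.norm_eq_abs,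
      Real.norm_eq_abs, Real.norm_eq_abs, abs_two]
    gcongr
    · exact (hB x hxt).1
    · exact (abs_im_le_norm _).trans ((hB x hxt).2 k z₀ ν)
  · exact (MemLp.integrable_mul (p := 2) (q := 2) hk.norm
      (hz.norm.add (hk.norm.mul_const B))).const_mul _
  · refine Eventually.of_forall fun ν x _ => ?_
    refine ((hasDerivAt_bathMode hv x ν).norm_sq).congr_deriv ?_
    simp [Complex.inner]
    ring

end Bath

/-! ### Velocities whose Fourier transform is controlled by a weight -/

section Tauberian

open scoped FourierTransform SchwartzMap ContDiff Convolution

theorem integrable_mul_of_bounded {φ : ℝ → ℂ} (hφ : Integrable φ) {v : ℝ → ℝ} (hv : Continuous v)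
    {Q : ℝ} (hQ : ∀ t, |v t| ≤ Q) : Integrable fun y => φ y * (v y : ℂ) := by
  refine hφ.mul_bdd (c := Q) (by fun_prop) (Eventually.of_forall fun y => ?_)
  simpa using hQ y

/-- A bounded Lipschitz function tends to zero if its square has bounded integrals over the
intervals `[0, b]`. -/
theorem tendsto_zero_of_sq_integral_bounded {u : ℝ → ℂ} {Q L C : ℝ} (hQ : ∀ t, ‖u t‖ ≤ Q)
    (hL : ∀ s t, ‖u s - u t‖ ≤ L * |s - t|) (hC : ∀ b, 0 ≤ b → ∫ t in (0:ℝ)..b, ‖u t‖ ^ 2 ≤ C) :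
    Tendsto u atTop (𝓝 0) := by
  have hL0 : 0 ≤ L := by
    have := (norm_nonneg _).trans (hL 1 0)
    simpa using this
  have hQ0 : 0 ≤ Q := (norm_nonneg _).trans (hQ 0)
  have hu : Continuous u := by
    refine (LipschitzWith.of_dist_le_mul (K := ⟨L, hL0⟩) fun s t => ?_).continuous
    rw [dist_eq_norm, Real.dist_eq]
    exact hL s t
  have hu2 : Continuous fun t => ‖u t‖ ^ 2 := by fun_prop
  set P : ℝ → ℝ := fun b => ∫ t in (0:ℝ)..b, ‖u t‖ ^ 2 with hP
  have hPd : ∀ t, HasDerivAt P (‖u t‖ ^ 2) t := fun t =>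
    intervalIntegral.integral_hasDerivAt_right (hu2.intervalIntegrable _ _)
      hu2.aestronglyMeasurable.stronglyMeasurableAtFilter hu2.continuousAt
  have hmono : Monotone P := monotone_of_deriv_nonneg (fun t => (hPd t).differentiableAt)
    fun t => by rw [(hPd t).deriv]; positivity
  have hbdd : BddAbove (Set.range P) := by
    refine ⟨C, ?_⟩
    rintro _ ⟨b, rfl⟩
    exact (hmono (le_max_left b 0)).trans (hC _ (le_max_right b 0))
  have hlim := tendsto_atTop_ciSup hmono hbdd
  have key : Tendsto (fun t => ‖u t‖ ^ 2) atTop (𝓝 0) := by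
    refine tendsto_zero_of_increments (f := P) (h := fun _ => 0) (L := 2 * Q * L)
      (by simpa using hPd) (fun s t => ?_) tendsto_const_nhds fun τ _ => ?_
    · have h1 : |‖u s‖ - ‖u t‖| ≤ L * |s - t| := (abs_norm_sub_norm_le _ _).trans (hL s t)
      rw [show ‖u s‖ ^ 2 - ‖u t‖ ^ 2 = (‖u s‖ + ‖u t‖) * (‖u s‖ - ‖u t‖) by ring, abs_mul,
        abs_of_nonneg (by positivity : 0 ≤ ‖u s‖ + ‖u t‖), mul_assoc]
      gcongr
      linarith [hQ s, hQ t]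
    · simpa using (hlim.comp (tendsto_atTop_add_const_right atTop τ tendsto_id)).sub hlim
  rw [tendsto_zero_iff_norm_tendsto_zero]
  have := key.sqrt
  simpa using this

variable {k v : ℝ → ℝ} {Q : ℝ}

/-- The part of a velocity `v` in the time interval `(-T, T]`. -/
noncomputable def truncated (v : ℝ → ℝ) (T : ℝ) : ℝ → ℂ :=
  (Set.Ioc (-T) T).indicator fun s => (v s : ℂ)

theorem norm_truncated_le (hQ : ∀ t, |v t| ≤ Q) (T t : ℝ) : ‖truncated v T t‖ ≤ Q := by
  have hQ0 : 0 ≤ Q := (abs_nonneg _).trans (hQ 0)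
  unfold truncated
  by_cases h : t ∈ Set.Ioc (-T) T
  · rw [Set.indicator_of_mem h]
    simpa using hQ t
  · rw [Set.indicator_of_notMem h]
    simpa using hQ0

theorem measurable_truncated (hv : Continuous v) (T : ℝ) : Measurable (truncated v T) :=
  Measurable.indicator (by fun_prop) measurableSet_Ioc

theorem integrable_pow_mul_truncated (hv : Continuous v) (T : ℝ) (n : ℕ) :
    Integrable fun x : ℝ => ‖x‖ ^ n * ‖truncated v T x‖ := by
  have h1 : (fun x : ℝ => ‖x‖ ^ n * ‖truncated v T x‖) =
      (Set.Ioc (-T) T).indicator fun x => ‖x‖ ^ n * ‖(v x : ℂ)‖ := by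
    ext x
    unfold truncated
    by_cases h : x ∈ Set.Ioc (-T) T <;> simp [h]
  rw [h1]
  have h2 : Continuous fun x : ℝ => ‖x‖ ^ n * ‖(v x : ℂ)‖ := by fun_prop
  exact (h2.integrableOn_Ioc).integrable_indicator measurableSet_Ioc

theorem integrable_truncated (hv : Continuous v) (T : ℝ) : Integrable (truncated v T) := by
  have := integrable_pow_mul_truncated hv T 0
  simp only [pow_zero, one_mul] at this
  exact (integrable_norm_iff (measurable_truncated hv T).aestronglyMeasurable).1 this

theorem fourier_truncated {T : ℝ} (hT : 0 ≤ T) (ξ : ℝ) :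
    𝓕 (truncated v T) ξ =
      ∫ s in (-T)..T, Complex.exp (-(Complex.I * (2 * Real.pi * ξ : ℝ) * s)) * v s := by
  rw [Real.fourier_eq', intervalIntegral.integral_of_le (by linarith),
    ← integral_indicator measurableSet_Ioc]
  congr 1
  ext s
  unfold truncated
  by_cases h : s ∈ Set.Ioc (-T) T
  · simp only [Set.indicator_of_mem h, smul_eq_mul]
    congr 2
    simp
    ring
  · simp [Set.indicator_of_notMem h]

/-- If `k · 𝓕(v 1_{(-T, T]})` is bounded in `L²` uniformly in `T`, where `k` has no zeros except
possibly the origin, then `φ * v → 0` for every Schwartz function `φ` whose spectrum is compact and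
avoids the origin: by Plancherel's formula `φ * v` is square integrable, and it is Lipschitz. -/
theorem tendsto_schwartz_convolution (hk : ContinuousOn k {0}ᶜ) (hk0 : ∀ ν, ν ≠ 0 → k ν ≠ 0)
    (hv : Continuous v) (hQ : ∀ t, |v t| ≤ Q) {L C : ℝ} (hL : ∀ s t, |v s - v t| ≤ L * |s - t|)
    (hint : ∀ T, 0 ≤ T → Integrable fun ν : ℝ => (|k ν| *
      ‖∫ s in (-T)..T, Complex.exp (-(Complex.I * ν * s)) * (v s : ℂ)‖) ^ 2)
    (hC : ∀ T, 0 ≤ T → ∫ ν : ℝ, (|k ν| *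
      ‖∫ s in (-T)..T, Complex.exp (-(Complex.I * ν * s)) * (v s : ℂ)‖) ^ 2 ≤ C)
    (φ : 𝓢(ℝ, ℂ)) (hφ : HasCompactSupport ((𝓕 φ : 𝓢(ℝ, ℂ)) : ℝ → ℂ))
    (hφ0 : tsupport ((𝓕 φ : 𝓢(ℝ, ℂ)) : ℝ → ℂ) ⊆ {0}ᶜ) :
    Tendsto (fun x => ∫ y, φ y * (v (x - y) : ℂ)) atTop (𝓝 0) := by
  have hQ0 : 0 ≤ Q := (abs_nonneg _).trans (hQ 0)
  have hpi : (0:ℝ) < 2 * Real.pi := by positivity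
  -- The spectrum of `φ` is dominated by the weight.
  obtain ⟨M, hM0, hM⟩ : ∃ M, 0 ≤ M ∧ ∀ ξ, ‖(𝓕 φ : 𝓢(ℝ, ℂ)) ξ‖ ≤ M * |k (2 * Real.pi * ξ)| := by
    have hcont : ContinuousOn (fun ξ => ‖(𝓕 φ : 𝓢(ℝ, ℂ)) ξ‖ / |k (2 * Real.pi * ξ)|)
        (tsupport ((𝓕 φ : 𝓢(ℝ, ℂ)) : ℝ → ℂ)) := by
      have h1 : Continuous ((𝓕 φ : 𝓢(ℝ, ℂ)) : ℝ → ℂ) := (𝓕 φ : 𝓢(ℝ, ℂ)).continuous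
      refine h1.norm.continuousOn.div ?_ fun ξ hξ => ?_
      · refine (hk.comp (by fun_prop) fun ξ hξ => ?_).abs
        have := hφ0 hξ
        simp at this
        simp [this, Real.pi_ne_zero]
      · have := hφ0 hξ
        simp at this
        exact abs_ne_zero.2 (hk0 _ (by simp [this, Real.pi_ne_zero]))
    obtain ⟨M, hM⟩ := IsCompact.exists_bound_of_continuousOn hφ hcont
    refine ⟨max M 0, le_max_right _ _, fun ξ => ?_⟩
    by_cases hξ : ξ ∈ tsupport ((𝓕 φ : 𝓢(ℝ, ℂ)) : ℝ → ℂ)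
    · have h0 := hφ0 hξ
      simp at h0
      have h1 : 0 < |k (2 * Real.pi * ξ)| :=
        abs_pos.2 (hk0 _ (by simp [h0, Real.pi_ne_zero]))
      have h2 := hM ξ hξ
      rw [Real.norm_eq_abs, abs_of_nonneg (by positivity), div_le_iff₀ h1] at h2
      exact h2.trans (by gcongr; exact le_max_left _ _)
    · rw [image_eq_zero_of_notMem_tsupport hξ, norm_zero]
      positivity
  set w : ℝ → ℝ → ℂ := fun T x => ∫ y, φ y * truncated v T (x - y) with hw
  have hwconv : ∀ T, w T = (truncated v T ⋆[ContinuousLinearMap.mul ℂ ℂ] φ) := by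
    intro T
    ext x
    rw [convolution_eq_swap]
    simp only [hw, ContinuousLinearMap.mul_apply', mul_comm]
  have hwcont : ∀ T, Continuous (w T) := by
    intro T
    rw [hwconv]
    refine BddAbove.continuous_convolution_right_of_integrable _ ?_ (integrable_truncated hv T)
      φ.continuous
    obtain ⟨B, hB⟩ := φ.toBoundedContinuousFunction.bddAbove_range_norm_comp
    exact ⟨B, hB⟩
  have hwbound : ∀ T x, ‖w T x‖ ≤ Q * ∫ y, ‖φ y‖ := by
    intro T x
    rw [← integral_const_mul]
    refine norm_integral_le_of_norm_le (φ.integrable.norm.const_mul _)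
      (Eventually.of_forall fun y => ?_)
    rw [norm_mul, mul_comm]
    gcongr
    exact norm_truncated_le hQ _ _
  have hwL2 : ∀ T, 0 ≤ T → Integrable (fun x => ‖w T x‖ ^ 2) ∧
      ∫ x, ‖w T x‖ ^ 2 ≤ M ^ 2 * ((2 * Real.pi)⁻¹ * C) := by
    intro T hT
    have hsm : ContDiff ℝ ∞ (𝓕 (truncated v T)) :=
      Real.contDiff_fourier fun n _ => integrable_pow_mul_truncated hv T n
    have hGs : ContDiff ℝ ∞ fun ξ => 𝓕 (truncated v T) ξ * (𝓕 φ : 𝓢(ℝ, ℂ)) ξ :=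
      hsm.mul ((𝓕 φ : 𝓢(ℝ, ℂ)).smooth ⊤)
    have hGc : HasCompactSupport fun ξ => 𝓕 (truncated v T) ξ * (𝓕 φ : 𝓢(ℝ, ℂ)) ξ := hφ.mul_left
    set G : 𝓢(ℝ, ℂ) := hGc.toSchwartzMap hGs with hG
    have hFw : 𝓕 (w T) = G := by
      ext ξ
      rw [hwconv, Real.fourier_mul_convolution_eq (integrable_truncated hv T) φ.integrable]
      simp [hG, SchwartzMap.fourier_coe]
    have hweq : (𝓕⁻ G : 𝓢(ℝ, ℂ)) = w T := by
      rw [SchwartzMap.fourierInv_coe, ← hFw]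
      refine (hwcont T).fourierInv_fourier_eq ?_ ?_
      · rw [hwconv]
        exact (integrable_truncated hv T).integrable_convolution _ φ.integrable
      · rw [hFw]
        exact G.integrable
    have h1 : ∫ x, ‖w T x‖ ^ 2 = ∫ ξ, ‖G ξ‖ ^ 2 := by
      have := SchwartzMap.integral_norm_sq_fourier (𝓕⁻ G : 𝓢(ℝ, ℂ))
      rw [FourierInvPair.fourier_fourierInv_eq] at this
      rw [this, ← hweq]
    refine ⟨?_, ?_⟩
    · rw [← hweq]
      exact ((𝓕⁻ G : 𝓢(ℝ, ℂ)).memLp 2).norm.integrable_sq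
    · rw [h1]
      set H : ℝ → ℝ := fun ν => (|k ν| *
        ‖∫ s in (-T)..T, Complex.exp (-(Complex.I * ν * s)) * (v s : ℂ)‖) ^ 2 with hH
      have h2 : ∀ ξ, ‖G ξ‖ ^ 2 ≤ M ^ 2 * H (2 * Real.pi * ξ) := by
        intro ξ
        have : G ξ = 𝓕 (truncated v T) ξ * (𝓕 φ : 𝓢(ℝ, ℂ)) ξ := rfl
        rw [this, fourier_truncated hT, norm_mul, hH]
        simp only
        rw [← mul_pow]
        refine pow_le_pow_left₀ (by positivity) ?_ 2
        refine (mul_le_mul_of_nonneg_left (hM ξ) (norm_nonneg _)).trans_eq ?_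
        ring
      calc ∫ ξ, ‖G ξ‖ ^ 2 ≤ ∫ ξ, M ^ 2 * H (2 * Real.pi * ξ) := by
            refine integral_mono (G.memLp 2).norm.integrable_sq ?_ h2
            exact ((hint T hT).comp_mul_left' hpi.ne').const_mul _
        _ = M ^ 2 * ((2 * Real.pi)⁻¹ * ∫ ν, H ν) := by
            rw [integral_const_mul, Measure.integral_comp_mul_left, abs_of_pos (by positivity),
              smul_eq_mul]
        _ ≤ _ := by
            gcongr
            exact hC T hT
  have hconvint : ∀ x, Integrable fun y => φ y * (v (x - y) : ℂ) := fun x =>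
    integrable_mul_of_bounded φ.integrable (v := fun y => v (x - y)) (by fun_prop)
      fun t => hQ _
  have hlim : ∀ x, Tendsto (fun n : ℕ => w n x) atTop (𝓝 (∫ y, φ y * (v (x - y) : ℂ))) := by
    intro x
    refine tendsto_integral_of_dominated_convergence (fun y => ‖φ y‖ * Q) (fun n => ?_)
      (φ.integrable.norm.mul_const Q) (fun n => Eventually.of_forall fun y => ?_)
      (Eventually.of_forall fun y => ?_)
    · exact φ.continuous.aestronglyMeasurable.mul
        ((measurable_truncated hv _).comp (by fun_prop)).aestronglyMeasurable
    · rw [norm_mul]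
      gcongr
      exact norm_truncated_le hQ _ _
    · refine tendsto_const_nhds.congr' ?_
      filter_upwards [eventually_gt_atTop ⌈|x - y|⌉₊] with n hn
      have h1 : |x - y| < n := (Nat.le_ceil _).trans_lt (by exact_mod_cast hn)
      rw [abs_lt] at h1
      unfold truncated
      have h2 : x - y ∈ Set.Ioc (-(n : ℝ)) n := ⟨h1.1, h1.2.le⟩
      rw [Set.indicator_of_mem h2]
  refine tendsto_zero_of_sq_integral_bounded (Q := Q * ∫ y, ‖φ y‖) (L := (∫ y, ‖φ y‖) * L)
    (C := M ^ 2 * ((2 * Real.pi)⁻¹ * C)) (fun x => ?_) (fun s t => ?_) fun b hb => ?_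
  · exact le_of_tendsto (hlim x).norm (Eventually.of_forall fun n => hwbound n x)
  · rw [← integral_sub (hconvint s) (hconvint t), mul_assoc, ← integral_mul_const]
    refine norm_integral_le_of_norm_le (φ.integrable.norm.mul_const _)
      (Eventually.of_forall fun y => ?_)
    rw [← mul_sub, norm_mul]
    gcongr
    have := hL (s - y) (t - y)
    rw [show s - y - (t - y) = s - t by ring] at this
    rw [← Complex.ofReal_sub, Complex.norm_real]
    exact this
  · have h1 : Tendsto (fun n : ℕ => ∫ x in (0:ℝ)..b, ‖w n x‖ ^ 2) atTop
        (𝓝 (∫ x in (0:ℝ)..b, ‖∫ y, φ y * (v (x - y) : ℂ)‖ ^ 2)) := by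
      refine intervalIntegral.tendsto_integral_filter_of_dominated_convergence
        (fun _ => (Q * ∫ y, ‖φ y‖) ^ 2) (Eventually.of_forall fun n => ?_)
        (Eventually.of_forall fun n => Eventually.of_forall fun x _ => ?_)
        intervalIntegrable_const (Eventually.of_forall fun x _ => ((hlim x).norm.pow 2))
      · exact ((hwcont n).norm.pow 2).aestronglyMeasurable
      · rw [norm_pow, norm_norm]
        gcongr
        exact hwbound n x
    refine le_of_tendsto h1 (Eventually.of_forall fun n => ?_)
    have h2 := hwL2 n (Nat.cast_nonneg n)
    rw [intervalIntegral.integral_of_le hb]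
    exact (setIntegral_le_integral h2.1 (Eventually.of_forall fun x => by positivity)).trans h2.2

end Tauberian

/-! ### Smooth frequency cutoffs and the decay of the velocity -/

section Tauberian

open scoped FourierTransform SchwartzMap ContDiff Convolution

/-- A smooth cutoff function on the frequency line, for `a > 0` equal to `1` on `[-a, a]`
and vanishing outside `[-2a, 2a]`. -/
noncomputable def lowPass (a : ℝ) (ξ : ℝ) : ℂ :=
  ((⟨1, 2, one_pos, one_lt_two⟩ : ContDiffBump (0 : ℝ)) (ξ / a) : ℝ)

theorem contDiff_lowPass (a : ℝ) : ContDiff ℝ ∞ (lowPass a) := by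
  unfold lowPass
  exact Complex.ofRealCLM.contDiff.comp ((ContDiffBump.contDiff _).comp (by fun_prop))

theorem lowPass_eq_one {a ξ : ℝ} (ha : 0 < a) (hξ : |ξ| ≤ a) : lowPass a ξ = 1 := by
  unfold lowPass
  rw [ContDiffBump.one_of_mem_closedBall]
  · simp
  · simpa [abs_div, abs_of_pos ha, div_le_one ha] using hξ

theorem lowPass_eq_zero {a ξ : ℝ} (ha : 0 < a) (hξ : 2 * a ≤ |ξ|) : lowPass a ξ = 0 := by
  unfold lowPass
  rw [ContDiffBump.zero_of_le_dist]
  · simp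
  · simpa [abs_div, abs_of_pos ha, le_div_iff₀ ha] using hξ

theorem hasCompactSupport_lowPass {a : ℝ} (ha : 0 < a) : HasCompactSupport (lowPass a) :=
  HasCompactSupport.of_support_subset_isCompact (isCompact_closedBall (0 : ℝ) (2 * a))
    fun ξ hξ => by
      by_contra hcon
      rw [mem_closedBall_zero_iff, Real.norm_eq_abs, not_le] at hcon
      exact hξ (lowPass_eq_zero ha hcon.le)

/-- The Schwartz function whose Fourier transform is `lowPass a`. -/
noncomputable def lowPassKernel (a : ℝ) (ha : 0 < a) : 𝓢(ℝ, ℂ) :=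
  𝓕⁻ ((hasCompactSupport_lowPass ha).toSchwartzMap (contDiff_lowPass a))

theorem fourier_lowPassKernel {a : ℝ} (ha : 0 < a) :
    ((𝓕 (lowPassKernel a ha) : 𝓢(ℝ, ℂ)) : ℝ → ℂ) = lowPass a := by
  rw [lowPassKernel, FourierInvPair.fourier_fourierInv_eq]
  rfl

theorem lowPassKernel_apply {a : ℝ} (ha : 0 < a) (x : ℝ) :
    lowPassKernel a ha x = a * lowPassKernel 1 one_pos (a * x) := by
  have h : ∀ (b : ℝ) (hb : 0 < b) (x : ℝ), lowPassKernel b hb x = 𝓕⁻ (lowPass b) x := by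
    intro b hb x
    rw [lowPassKernel, SchwartzMap.fourierInv_coe]
    rfl
  rw [h, h, Real.fourierInv_eq', Real.fourierInv_eq']
  have h1 := Measure.integral_comp_div (fun ξ : ℝ =>
    Complex.exp (↑(2 * Real.pi * inner ℝ ξ (a * x)) * Complex.I) • lowPass 1 ξ) a
  rw [abs_of_pos ha] at h1
  rw [← Complex.real_smul, ← h1]
  congr 1
  ext ξ
  have h2 : lowPass a ξ = lowPass 1 (ξ / a) := by simp [lowPass]
  have h3 : inner ℝ ξ x = inner ℝ (ξ / a) (a * x) := by
    simp only [RCLike.inner_apply, conj_trivial]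
    field_simp
  rw [h2, h3]

theorem integral_lowPassKernel : ∫ x, lowPassKernel 1 one_pos x = 1 := by
  have h1 : (𝓕 (lowPassKernel 1 one_pos) : 𝓢(ℝ, ℂ)) 0 = 1 := by
    rw [fourier_lowPassKernel, lowPass_eq_one one_pos (by simp)]
  rw [SchwartzMap.fourier_coe, Real.fourier_eq'] at h1
  simpa using h1

theorem integral_lowPassKernel_mul {a : ℝ} (ha : 0 < a) (v : ℝ → ℝ) (x : ℝ) :
    ∫ y, lowPassKernel a ha y * (v (x - y) : ℂ) =
      ∫ y, lowPassKernel 1 one_pos y * (v (x - y / a) : ℂ) := by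
  have h1 := Measure.integral_comp_mul_left
    (fun y : ℝ => lowPassKernel 1 one_pos y * (v (x - y / a) : ℂ)) a
  rw [abs_of_pos (inv_pos.2 ha)] at h1
  have h2 : ∫ y, lowPassKernel 1 one_pos y * (v (x - y / a) : ℂ) =
      a • ∫ y, lowPassKernel 1 one_pos (a * y) * (v (x - a * y / a) : ℂ) := by
    rw [h1, smul_smul, mul_inv_cancel₀ ha.ne', one_smul]
  rw [h2, Complex.real_smul, ← integral_const_mul]
  congr 1
  ext y
  rw [lowPassKernel_apply ha, mul_div_cancel_left₀ _ ha.ne', mul_assoc]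

/-- Let `v = q'` be Lipschitz, with `q` and `v` bounded, and let `k · 𝓕(v 1_{(-T, T]})` be bounded
in `L²` uniformly in `T`, where `k` has no zeros except possibly the origin. Then `v → 0` at `+∞`.
The high frequencies of `v` are small because `v` is Lipschitz, the low ones because `v` has a
bounded primitive, and those in between decay by `tendsto_schwartz_convolution`. -/
theorem tendsto_zero_of_weighted_fourier_bounded {k v q : ℝ → ℝ} {Q : ℝ}
    (hk : ContinuousOn k {0}ᶜ) (hk0 : ∀ ν, ν ≠ 0 → k ν ≠ 0)
    (hv : Continuous v) (hQ : ∀ t, |v t| ≤ Q) {L C : ℝ} (hL : ∀ s t, |v s - v t| ≤ L * |s - t|)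
    (hq : ∀ t, HasDerivAt q (v t) t) {N : ℝ} (hN : ∀ t, |q t| ≤ N)
    (hint : ∀ T, 0 ≤ T → Integrable fun ν : ℝ => (|k ν| *
      ‖∫ s in (-T)..T, Complex.exp (-(Complex.I * ν * s)) * (v s : ℂ)‖) ^ 2)
    (hC : ∀ T, 0 ≤ T → ∫ ν : ℝ, (|k ν| *
      ‖∫ s in (-T)..T, Complex.exp (-(Complex.I * ν * s)) * (v s : ℂ)‖) ^ 2 ≤ C) :
    Tendsto v atTop (𝓝 0) := by
  have hL0 : 0 ≤ L := by
    have := (abs_nonneg _).trans (hL 1 0)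
    simpa using this
  have hN0 : 0 ≤ N := (abs_nonneg _).trans (hN 0)
  have hqc : Continuous q := continuous_iff_continuousAt.2 fun t => (hq t).continuousAt
  set φ : 𝓢(ℝ, ℂ) := lowPassKernel 1 one_pos with hφ
  have hint1 : ∀ (x a : ℝ), Integrable fun y => φ y * (v (x - y / a) : ℂ) := fun x a =>
    integrable_mul_of_bounded φ.integrable (v := fun y => v (x - y / a)) (by fun_prop)
      fun t => hQ _
  have hint2 : ∀ (x a : ℝ) (ha : 0 < a),
      Integrable fun y => lowPassKernel a ha y * (v (x - y) : ℂ) := fun x a ha =>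
    integrable_mul_of_bounded (lowPassKernel a ha).integrable (v := fun y => v (x - y))
      (by fun_prop) fun t => hQ _
  have hmom : Integrable fun y : ℝ => ‖y‖ * ‖φ y‖ := by
    simpa using φ.integrable_pow_mul volume 1
  set c1 : ℝ := ∫ y, ‖y‖ * ‖φ y‖ with hc1
  have hc1' : 0 ≤ c1 := integral_nonneg fun y => by positivity
  have hφ' : Integrable fun y => deriv φ y := by
    have := (SchwartzMap.derivCLM ℝ ℂ φ).integrable (μ := volume)
    exact this.congr (Eventually.of_forall fun y => SchwartzMap.derivCLM_apply ℝ φ y)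
  set c2 : ℝ := ∫ y, ‖deriv φ y‖ with hc2
  have hc2' : 0 ≤ c2 := integral_nonneg fun y => by positivity
  have high : ∀ (R : ℝ), 0 < R → ∀ x,
      ‖(v x : ℂ) - ∫ y, φ y * (v (x - y / R) : ℂ)‖ ≤ L / R * c1 := by
    intro R hR x
    have h1 : (v x : ℂ) = ∫ y, φ y * (v x : ℂ) := by
      rw [integral_mul_const, integral_lowPassKernel, one_mul]
    rw [h1, ← integral_sub (φ.integrable.mul_const _) (hint1 x R), hc1, ← integral_const_mul]
    refine norm_integral_le_of_norm_le (hmom.const_mul _) (Eventually.of_forall fun y => ?_)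
    rw [← mul_sub, norm_mul, ← Complex.ofReal_sub, Complex.norm_real, Real.norm_eq_abs]
    have h2 := hL x (x - y / R)
    rw [sub_sub_cancel, abs_div, abs_of_pos hR] at h2
    calc ‖φ y‖ * |v x - v (x - y / R)| ≤ ‖φ y‖ * (L * (|y| / R)) := by gcongr
      _ = _ := by rw [Real.norm_eq_abs]; ring
  have low : ∀ (ε : ℝ), 0 < ε → ∀ x, ‖∫ y, φ y * (v (x - y / ε) : ℂ)‖ ≤ ε * (N * c2) := by
    intro ε hε x
    have hw : ∀ y : ℝ, HasDerivAt (fun y : ℝ => (q (x - y / ε) : ℂ))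
        (-(ε : ℂ)⁻¹ * (v (x - y / ε) : ℂ)) y := by
      intro y
      have h1 : HasDerivAt (fun y : ℝ => x - y / ε) (-(1 / ε)) y :=
        ((hasDerivAt_id y).div_const ε).const_sub x
      have h2 := ((hq (x - y / ε)).comp y h1).ofReal_comp
      refine h2.congr_deriv ?_
      push_cast
      ring
    have hqint : ∀ {f : ℝ → ℂ}, Integrable f → Integrable fun y => f y * (q (x - y / ε) : ℂ) :=
      fun hf => integrable_mul_of_bounded hf (v := fun y => q (x - y / ε)) (by fun_prop)
        fun t => hN _
    have hparts := integral_mul_deriv_eq_deriv_mul_of_integrable (u := φ) (u' := deriv φ)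
      (v := fun y : ℝ => (q (x - y / ε) : ℂ)) (v' := fun y => -(ε : ℂ)⁻¹ * (v (x - y / ε) : ℂ))
      (fun y _ => φ.differentiableAt.hasDerivAt) (fun y _ => hw y)
      (by
        refine ((hint1 x ε).const_mul (-(ε : ℂ)⁻¹)).congr (Eventually.of_forall fun y => ?_)
        simp only [Pi.mul_apply]
        ring) (hqint hφ') (hqint φ.integrable)
    have hε' : (ε : ℂ) ≠ 0 := by exact_mod_cast hε.ne'
    have h3 : ∫ y, φ y * (v (x - y / ε) : ℂ) = ε * ∫ y, deriv φ y * (q (x - y / ε) : ℂ) := by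
      have h4 : ∫ y, φ y * (-(ε : ℂ)⁻¹ * (v (x - y / ε) : ℂ)) =
          -(ε : ℂ)⁻¹ * ∫ y, φ y * (v (x - y / ε) : ℂ) := by
        rw [← integral_const_mul]
        congr 1
        ext y
        ring
      rw [h4] at hparts
      linear_combination (-(ε : ℂ)) * hparts -
        (∫ y, φ y * (v (x - y / ε) : ℂ)) * mul_inv_cancel₀ hε'
    rw [h3, norm_mul, Complex.norm_real, Real.norm_eq_abs, abs_of_pos hε, hc2,
      ← integral_const_mul]
    gcongr
    refine norm_integral_le_of_norm_le (hφ'.norm.const_mul _) (Eventually.of_forall fun y => ?_)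
    rw [norm_mul, Complex.norm_real, Real.norm_eq_abs, mul_comm]
    gcongr
    exact hN _
  have band : ∀ (R ε : ℝ) (hR : 0 < R) (hε : 0 < ε), Tendsto (fun x =>
      (∫ y, φ y * (v (x - y / R) : ℂ)) - ∫ y, φ y * (v (x - y / ε) : ℂ)) atTop (𝓝 0) := by
    intro R ε hR hε
    have hF : ((𝓕 (lowPassKernel R hR - lowPassKernel ε hε) : 𝓢(ℝ, ℂ)) : ℝ → ℂ) =
        fun ξ => lowPass R ξ - lowPass ε ξ := by
      have h1 : (𝓕 (lowPassKernel R hR - lowPassKernel ε hε) : 𝓢(ℝ, ℂ)) =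
          𝓕 (lowPassKernel R hR) - 𝓕 (lowPassKernel ε hε) :=
        map_sub (FourierTransform.fourierCLM ℂ 𝓢(ℝ, ℂ)) _ _
      rw [h1]
      ext ξ
      rw [sub_apply, fourier_lowPassKernel, fourier_lowPassKernel]
    have := tendsto_schwartz_convolution hk hk0 hv hQ hL hint hC
      (lowPassKernel R hR - lowPassKernel ε hε) (by
        rw [hF]
        exact (hasCompactSupport_lowPass hR).sub (hasCompactSupport_lowPass hε)) (by
        rw [hF]
        intro ξ hξ h0
        rw [Set.mem_singleton_iff] at h0
        subst h0
        refine notMem_tsupport_iff_eventuallyEq.2 ?_ hξ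
        filter_upwards [Metric.ball_mem_nhds (0:ℝ) (lt_min hR hε)] with ξ hξ
        rw [mem_ball_zero_iff, Real.norm_eq_abs, lt_min_iff] at hξ
        simp [lowPass_eq_one hR hξ.1.le, lowPass_eq_one hε hξ.2.le])
    refine this.congr fun x => ?_
    rw [← integral_lowPassKernel_mul hR, ← integral_lowPassKernel_mul hε,
      ← integral_sub (hint2 x R hR) (hint2 x ε hε)]
    congr 1
    ext y
    rw [sub_apply]
    ring
  rw [Metric.tendsto_atTop]
  intro δ hδ
  set R : ℝ := 3 * (L * c1 + 1) / δ with hR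
  have hRpos : 0 < R := by positivity
  set ε : ℝ := δ / (3 * (N * c2 + 1)) with hε
  have hεpos : 0 < ε := by positivity
  have hR1 : L / R * c1 < δ / 3 := by
    rw [div_mul_eq_mul_div, div_lt_iff₀ hRpos, hR]
    field_simp
    linarith
  have hε1 : ε * (N * c2) < δ / 3 := by
    rw [hε, div_mul_eq_mul_div, div_lt_iff₀ (by positivity)]
    field_simp
    nlinarith
  obtain ⟨T, hT⟩ := (Metric.tendsto_atTop.1 (band R ε hRpos hεpos)) (δ / 3) (by positivity)
  refine ⟨T, fun x hx => ?_⟩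
  have h1 := hT x hx
  rw [dist_zero_right] at h1
  have h2 := high R hRpos x
  have h3 := low ε hεpos x
  rw [dist_zero_right, ← Complex.norm_real]
  have h4 : (v x : ℂ) = ((v x : ℂ) - ∫ y, φ y * (v (x - y / R) : ℂ)) +
      ((∫ y, φ y * (v (x - y / R) : ℂ)) - ∫ y, φ y * (v (x - y / ε) : ℂ)) +
      ∫ y, φ y * (v (x - y / ε) : ℂ) := by ring
  rw [h4]
  refine (norm_add₃_le).trans_lt ?_
  linarith

end Tauberian

/-! ### Dispersion of the energy of a thermostat -/

section Bath

open scoped FourierTransform SchwartzMap ContDiff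
open Complex

variable {k v : ℝ → ℝ} {z₀ : ℝ → ℂ}

/-- A bound on the energy of a thermostat at all times bounds the Fourier transform of the driving
velocity `v`, cut off to a bounded time interval, in `L²` with the weight `k²`: up to phases,
`k ∫ exp (-iνs) v(s) ds` over an interval is the increment of the amplitude over this interval. -/
theorem weighted_fourier_bounded (hv : Continuous v) (hk : MemLp k 2) (hz : MemLp z₀ 2) {C : ℝ}
    (hC : ∀ t, ∫ ν, ‖bathMode k v z₀ t ν‖ ^ 2 ≤ C) (T : ℝ) :
    Integrable (fun ν : ℝ => (|k ν| * ‖∫ s in (-T)..T, exp (-(I * ν * s)) * (v s : ℂ)‖) ^ 2) ∧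
      ∫ ν : ℝ, (|k ν| * ‖∫ s in (-T)..T, exp (-(I * ν * s)) * (v s : ℂ)‖) ^ 2 ≤ 4 * C := by
  have hi : ∀ t, Integrable fun ν => ‖bathMode k v z₀ t ν‖ ^ 2 := fun t =>
    (memLp_bathMode hv hk hz t).norm.integrable_sq
  have hle : ∀ ν : ℝ, (|k ν| * ‖∫ s in (-T)..T, exp (-(I * ν * s)) * (v s : ℂ)‖) ^ 2 ≤
      2 * (‖bathMode k v z₀ T ν‖ ^ 2 + ‖bathMode k v z₀ (-T) ν‖ ^ 2) := by
    intro ν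
    have hc : Continuous fun s : ℝ => exp (-(I * ν * s)) * (v s : ℂ) := by fun_prop
    have h1 : ∫ s in (-T)..T, exp (-(I * ν * s)) * (v s : ℂ) =
        (∫ s in (0:ℝ)..T, exp (-(I * ν * s)) * (v s : ℂ)) -
          ∫ s in (0:ℝ)..(-T), exp (-(I * ν * s)) * (v s : ℂ) :=
      (intervalIntegral.integral_interval_sub_left (hc.intervalIntegrable _ _)
        (hc.intervalIntegrable _ _)).symm
    have h2 : ∀ t : ℝ, exp (-(I * ν * t)) * bathMode k v z₀ t ν =
        z₀ ν - I * k ν * ∫ s in (0 : ℝ)..t, exp (-(I * ν * s)) * v s := by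
      intro t
      rw [bathMode, ← mul_assoc, ← exp_add]
      simp
    have h3 : I * (k ν * ∫ s in (-T)..T, exp (-(I * ν * s)) * (v s : ℂ)) =
        exp (-(I * ν * (-T : ℝ))) * bathMode k v z₀ (-T) ν -
          exp (-(I * ν * T)) * bathMode k v z₀ T ν := by
      rw [h2, h2, h1]
      ring
    have h4 : |k ν| * ‖∫ s in (-T)..T, exp (-(I * ν * s)) * (v s : ℂ)‖ ≤
        ‖bathMode k v z₀ (-T) ν‖ + ‖bathMode k v z₀ T ν‖ := by
      have h5 := norm_sub_le (exp (-(I * ν * (-T : ℝ))) * bathMode k v z₀ (-T) ν)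
        (exp (-(I * ν * T)) * bathMode k v z₀ T ν)
      rw [← h3, norm_mul, norm_mul, norm_I, one_mul, norm_real, norm_mul, norm_mul,
        norm_exp_neg_I_mul_mul, norm_exp_neg_I_mul_mul, one_mul, one_mul] at h5
      exact h5
    refine (pow_le_pow_left₀ (by positivity) h4 2).trans ?_
    nlinarith [sq_nonneg (‖bathMode k v z₀ (-T) ν‖ - ‖bathMode k v z₀ T ν‖)]
  have hint2 : Integrable fun ν =>
      2 * (‖bathMode k v z₀ T ν‖ ^ 2 + ‖bathMode k v z₀ (-T) ν‖ ^ 2) :=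
    ((hi T).add (hi (-T))).const_mul 2
  have hint1 : Integrable fun ν : ℝ =>
      (|k ν| * ‖∫ s in (-T)..T, exp (-(I * ν * s)) * (v s : ℂ)‖) ^ 2 := by
    refine hint2.mono ?_ (Eventually.of_forall fun ν => ?_)
    · exact ((hk.1.norm.mul (continuous_freq_integral hv (-T) T).norm.aestronglyMeasurable).pow 2)
    · rw [Real.norm_of_nonneg (by positivity), Real.norm_of_nonneg (by positivity)]
      exact hle ν
  refine ⟨hint1, (integral_mono hint1 hint2 hle).trans ?_⟩
  rw [integral_const_mul, integral_add (hi T) (hi (-T))]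
  linarith [hC T, hC (-T)]

theorem integrable_fourier_smooth {s : ℝ → ℝ} (hs : ContDiff ℝ ∞ s) (hsc : HasCompactSupport s) :
    Integrable fun τ : ℝ => ∫ ν : ℝ, (s ν : ℂ) * exp (I * ν * τ) := by
  set S : 𝓢(ℝ, ℂ) := (hsc.comp_left (g := Complex.ofReal) ofReal_zero).toSchwartzMap
    (ofRealCLM.contDiff.comp hs) with hS
  have h1 : ∀ τ : ℝ, (𝓕⁻ S : 𝓢(ℝ, ℂ)) (τ / (2 * Real.pi)) =
      ∫ ν : ℝ, (s ν : ℂ) * exp (I * ν * τ) := by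
    intro τ
    rw [SchwartzMap.fourierInv_coe, Real.fourierInv_eq']
    congr 1
    ext ν
    rw [smul_eq_mul, mul_comm]
    have h2 : S ν = (s ν : ℂ) := rfl
    have h3 : (2 * Real.pi * inner ℝ ν (τ / (2 * Real.pi)) : ℝ) = ν * τ := by
      simp only [RCLike.inner_apply, conj_trivial]
      field_simp
    rw [h2, h3]
    push_cast
    ring_nf
  have h2 := ((𝓕⁻ S : 𝓢(ℝ, ℂ)).integrable (μ := volume)).comp_div
    (show (2 * Real.pi : ℝ) ≠ 0 by positivity)
  exact h2.congr (Eventually.of_forall h1)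

theorem continuous_smooth_div (hk : ContinuousOn k {0}ᶜ) (hk0 : ∀ ν, ν ≠ 0 → k ν ≠ 0)
    {s : ℝ → ℝ} (hs : Continuous s) (hs0 : tsupport s ⊆ {0}ᶜ) :
    Continuous fun ν => s ν / k ν := by
  refine continuous_of_tsupport fun x hx => ?_
  have h1 : x ∈ tsupport s := by
    refine closure_mono (fun y hy => ?_) hx
    rw [Function.mem_support] at hy ⊢
    intro h
    exact hy (by simp [h])
  have h2 : x ≠ 0 := by simpa using hs0 h1
  exact hs.continuousAt.div (hk.continuousAt (isOpen_compl_singleton.mem_nhds (by simpa using h2)))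
    (hk0 x h2)

theorem memLp_smooth_div (hk : ContinuousOn k {0}ᶜ) (hk0 : ∀ ν, ν ≠ 0 → k ν ≠ 0)
    {s : ℝ → ℝ} (hs : Continuous s) (hsc : HasCompactSupport s) (hs0 : tsupport s ⊆ {0}ᶜ) :
    MemLp (fun ν => s ν / k ν) 2 := by
  refine (continuous_smooth_div hk hk0 hs hs0).memLp_of_hasCompactSupport ?_
  refine hsc.mono fun y hy => ?_
  rw [Function.mem_support] at hy ⊢
  intro h
  exact hy (by simp [h])

/-- The pairing with a weight `s / k`, where `s` is smooth with compact support away from the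
origin, tends to zero when the driving velocity does: the contribution of the initial data vanishes
by the Riemann–Lebesgue lemma, and the memory kernel is the Fourier transform of `s`, which is
integrable. -/
theorem tendsto_bathPairing_smooth_div (hk : ContinuousOn k {0}ᶜ) (hk0 : ∀ ν, ν ≠ 0 → k ν ≠ 0)
    (hkL : MemLp k 2) (hv : Continuous v) {Q : ℝ} (hQ : ∀ t, |v t| ≤ Q) (hz : MemLp z₀ 2)
    (hlim : Tendsto v atTop (𝓝 0)) {s : ℝ → ℝ} (hs : ContDiff ℝ ∞ s) (hsc : HasCompactSupport s)
    (hs0 : tsupport s ⊆ {0}ᶜ) :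
    Tendsto (bathPairing k v z₀ fun ν => s ν / k ν) atTop (𝓝 0) := by
  have hQ0 : 0 ≤ Q := (abs_nonneg _).trans (hQ 0)
  have hg := memLp_smooth_div hk hk0 hs.continuous hsc hs0
  have hsint : Integrable s := hs.continuous.integrable_of_hasCompactSupport hsc
  set 𝔰 : ℝ → ℂ := fun τ => ∫ ν : ℝ, (s ν : ℂ) * exp (I * ν * τ) with h𝔰
  have h𝔰int : Integrable 𝔰 := integrable_fourier_smooth hs hsc
  have hfree : Integrable fun ν => (s ν / k ν : ℝ) * z₀ ν :=
    MemLp.integrable_mul (p := 2) (q := 2) hg.ofReal hz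
  have hfree' : ∀ t : ℝ, Integrable fun ν : ℝ => exp (I * ν * t) * ((s ν / k ν : ℝ) * z₀ ν) := by
    intro t
    refine hfree.bdd_mul (c := 1) (by fun_prop) (Eventually.of_forall fun ν => ?_)
    rw [norm_exp_I_mul_mul]
  have hsplit : ∀ t ν : ℝ, ((s ν / k ν : ℝ) : ℂ) * bathMode k v z₀ t ν =
      exp (I * ν * t) * ((s ν / k ν : ℝ) * z₀ ν) -
        I * ∫ u in (0:ℝ)..t, (s ν : ℂ) * exp (I * ν * (t - u : ℝ)) * v u := by
    intro t ν
    have h1 : ((s ν / k ν : ℝ) : ℂ) * k ν = s ν := by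
      by_cases h : ν = 0
      · have : s ν = 0 := by
          refine image_eq_zero_of_notMem_tsupport fun hmem => ?_
          exact hs0 hmem h
        simp [this]
      · have := hk0 ν h
        rw [← ofReal_mul, div_mul_cancel₀ _ this]
    have h2 : ∫ u in (0:ℝ)..t, (s ν : ℂ) * exp (I * ν * (t - u : ℝ)) * v u =
        (s ν * exp (I * ν * t)) * ∫ u in (0:ℝ)..t, exp (-(I * ν * u)) * v u := by
      rw [← intervalIntegral.integral_const_mul]
      congr 1
      ext u
      rw [show I * (ν : ℂ) * ((t - u : ℝ) : ℂ) = I * ν * t + -(I * ν * u) by push_cast; ring,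
        exp_add]
      ring
    rw [h2, bathMode, ← h1]
    ring
  have hmem : ∀ t : ℝ, ∫ ν : ℝ, ∫ u in (0:ℝ)..t, (s ν : ℂ) * exp (I * ν * (t - u : ℝ)) * v u =
      ∫ w in (0:ℝ)..t, 𝔰 w * v (t - w) := by
    intro t
    rw [← intervalIntegral_integral_swap]
    · have h1 := intervalIntegral.integral_comp_sub_left (a := 0) (b := t)
        (fun w => 𝔰 w * (v (t - w) : ℂ)) t
      simp only [sub_self, sub_zero, sub_sub_cancel] at h1
      rw [← h1]
      congr 1
      ext u
      rw [integral_mul_const]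
    · have h1 : Integrable (fun p : ℝ × ℝ => v p.1 * s p.2)
          ((volume.restrict (Set.uIoc 0 t)).prod volume) :=
        Integrable.mul_prod (hv.integrableOn_uIoc) hsint
      refine h1.mono ?_ (Eventually.of_forall fun p => ?_)
      · have hs' := hs.continuous
        refine Continuous.aestronglyMeasurable ?_
        unfold Function.uncurry
        fun_prop
      · simp only [Function.uncurry, norm_mul, norm_exp_I_mul_mul, norm_real]
        rw [mul_one, mul_comm]
  have heq : ∀ t, bathPairing k v z₀ (fun ν => s ν / k ν) t =
      (∫ ν : ℝ, exp (I * ν * t) * ((s ν / k ν : ℝ) * z₀ ν)) -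
        I * ∫ w in (0:ℝ)..t, 𝔰 w * v (t - w) := by
    intro t
    have h1 := (hfree' t).sub (integrable_mul_bathMode hv hkL hz hg t)
    have h2 : Integrable fun ν : ℝ =>
        I * ∫ u in (0:ℝ)..t, (s ν : ℂ) * exp (I * ν * (t - u : ℝ)) * v u := by
      refine h1.congr (Eventually.of_forall fun ν => ?_)
      simp only [Pi.sub_apply]
      rw [hsplit]
      ring
    rw [bathPairing]
    simp_rw [hsplit]
    rw [integral_sub (hfree' t) h2, integral_const_mul, hmem]
  have hRL : Tendsto (fun t : ℝ => ∫ ν : ℝ, exp (I * ν * t) * ((s ν / k ν : ℝ) * z₀ ν))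
      atTop (𝓝 0) := by
    have h1 := Real.tendsto_integral_exp_smul_cocompact (fun ν => ((s ν / k ν : ℝ) : ℂ) * z₀ ν)
    have h2 : Tendsto (fun t : ℝ => -(1 / (2 * Real.pi)) * t) atTop (cocompact ℝ) :=
      (tendsto_id.const_mul_atTop_of_neg (by
        have := Real.pi_pos
        simp; positivity)).mono_right atBot_le_cocompact
    refine (h1.comp h2).congr fun t => ?_
    simp only [Function.comp_apply]
    congr 1
    ext ν
    rw [Circle.smul_def, smul_eq_mul, Real.fourierChar_apply]
    congr 2
    push_cast
    have : (Real.pi : ℂ) ≠ 0 := by exact_mod_cast Real.pi_ne_zero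
    field_simp
  have hconv : Tendsto (fun t : ℝ => ∫ w in (0:ℝ)..t, 𝔰 w * v (t - w)) atTop (𝓝 0) := by
    have h1 : Tendsto (fun t : ℝ => ∫ w, (Set.Ioc 0 t).indicator (fun w => 𝔰 w * (v (t - w) : ℂ)) w)
        atTop (𝓝 (∫ _w : ℝ, (0 : ℂ))) := by
      refine tendsto_integral_filter_of_dominated_convergence (fun w => ‖𝔰 w‖ * Q)
        (Eventually.of_forall fun t => ?_)
        (Eventually.of_forall fun t => Eventually.of_forall fun w => ?_)
        (h𝔰int.norm.mul_const Q) (Eventually.of_forall fun w => ?_)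
      · exact (h𝔰int.1.mul (by fun_prop)).indicator measurableSet_Ioc
      · refine (norm_indicator_le_norm_self _ _).trans ?_
        rw [norm_mul, norm_real]
        gcongr
        exact hQ _
      · have h2 : Tendsto (fun t : ℝ => 𝔰 w * (v (t - w) : ℂ)) atTop (𝓝 0) := by
          have h3 : Tendsto (fun t : ℝ => ((v (t - w) : ℝ) : ℂ)) atTop (𝓝 ((0 : ℝ) : ℂ)) :=
            (continuous_ofReal.tendsto 0).comp
              (hlim.comp (tendsto_atTop_add_const_right atTop (-w) tendsto_id))
          simpa using h3.const_mul (𝔰 w)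
        refine squeeze_zero_norm (fun t => ?_) (tendsto_zero_iff_norm_tendsto_zero.1 h2)
        exact norm_indicator_le_norm_self _ _
    rw [integral_zero] at h1
    refine h1.congr' ?_
    filter_upwards [eventually_ge_atTop 0] with t ht
    rw [intervalIntegral.integral_of_le ht, integral_indicator measurableSet_Ioc]
  have := hRL.sub (hconv.const_mul I)
  rw [mul_zero, sub_zero] at this
  exact this.congr fun t => (heq t).symm

/-- The functions `s / k`, where `s` is smooth with compact support away from the origin, are dense
in `L²`. -/
theorem exists_smooth_div_approx (hk : ContinuousOn k {0}ᶜ) (hk0 : ∀ ν, ν ≠ 0 → k ν ≠ 0)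
    {g : ℝ → ℝ} (hg : MemLp g 2) {ε : ℝ} (hε : 0 < ε) :
    ∃ s : ℝ → ℝ, ContDiff ℝ ∞ s ∧ HasCompactSupport s ∧ tsupport s ⊆ {0}ᶜ ∧
      ∫ ν, (g ν - s ν / k ν) ^ 2 < ε := by
  let W : Submodule ℝ (Lp ℝ 2 (volume : Measure ℝ)) :=
    { carrier := {f | ∃ s : ℝ → ℝ, ContDiff ℝ ∞ s ∧ HasCompactSupport s ∧ tsupport s ⊆ {0}ᶜ ∧
        f =ᵐ[volume] fun ν => s ν / k ν}
      add_mem' := by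
        rintro a b ⟨s, h1, h2, h3, h4⟩ ⟨s', h1', h2', h3', h4'⟩
        refine ⟨s + s', h1.add h1', h2.add h2',
          (tsupport_add s s').trans (Set.union_subset h3 h3'), ?_⟩
        filter_upwards [h4, h4', Lp.coeFn_add a b] with ν e1 e2 e3
        rw [e3, Pi.add_apply, e1, e2, Pi.add_apply, add_div]
      zero_mem' := by
        refine ⟨0, contDiff_const, HasCompactSupport.zero, by simp [tsupport], ?_⟩
        filter_upwards [Lp.coeFn_zero ℝ 2 (volume : Measure ℝ)] with ν e
        rw [e]
        simp
      smul_mem' := by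
        rintro c a ⟨s, h1, h2, h3, h4⟩
        refine ⟨c • s, h1.const_smul c, h2.smul_left (f := fun _ => c),
          (closure_mono (Function.support_const_smul_subset c s)).trans h3, ?_⟩
        filter_upwards [h4, Lp.coeFn_smul c a] with ν e1 e2
        rw [e2, Pi.smul_apply, e1, Pi.smul_apply, smul_eq_mul, smul_eq_mul, mul_div_assoc] }
  have hW : W.topologicalClosure = ⊤ := by
    rw [Submodule.topologicalClosure_eq_top_iff, Submodule.eq_bot_iff]
    intro h hh
    rw [Submodule.mem_orthogonal] at hh
    have hloc : LocallyIntegrableOn (fun ν => (k ν)⁻¹ • h ν) {0}ᶜ volume := by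
      refine LocallyIntegrableOn.continuousOn_smul isOpen_compl_singleton.isLocallyClosed ?_
        (hk.inv₀ fun x hx => hk0 x hx)
      exact ((Lp.memLp h).locallyIntegrable one_le_two).locallyIntegrableOn _
    have hzero := isOpen_compl_singleton.ae_eq_zero_of_integral_contDiff_smul_eq_zero hloc
      (fun s hs hsc hs0 => by
        have hm := memLp_smooth_div hk hk0 hs.continuous hsc hs0
        have h1 := hh (hm.toLp _) ⟨s, hs, hsc, hs0, hm.coeFn_toLp⟩
        rw [L2.inner_def] at h1
        rw [← h1]
        refine integral_congr_ae ?_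
        filter_upwards [hm.coeFn_toLp] with ν e
        rw [e]
        simp only [smul_eq_mul, RCLike.inner_apply, conj_trivial]
        ring)
    rw [Lp.eq_zero_iff_ae_eq_zero]
    have hne : ∀ᵐ ν : ℝ, ν ≠ 0 := by
      simp [ae_iff, measure_singleton]
    filter_upwards [hzero, hne] with ν e1 e2
    have := e1 e2
    rw [smul_eq_mul, mul_eq_zero, inv_eq_zero] at this
    exact this.resolve_left (hk0 ν e2)
  have hmem : hg.toLp g ∈ closure (W : Set (Lp ℝ 2 (volume : Measure ℝ))) := by
    rw [← Submodule.topologicalClosure_coe, hW]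
    trivial
  obtain ⟨f, ⟨s, h1, h2, h3, h4⟩, hf⟩ := Metric.mem_closure_iff.1 hmem (√ε) (Real.sqrt_pos.2 hε)
  refine ⟨s, h1, h2, h3, ?_⟩
  rw [dist_eq_norm, ← sq_lt_sq₀ (norm_nonneg _) (Real.sqrt_nonneg _), Real.sq_sqrt hε.le,
    ← real_inner_self_eq_norm_sq, L2.inner_def] at hf
  refine lt_of_eq_of_lt (integral_congr_ae ?_) hf
  filter_upwards [h4, Lp.coeFn_sub (hg.toLp g) f, hg.coeFn_toLp] with ν e1 e2 e3
  rw [e2, Pi.sub_apply, e1, e3]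
  simp only [RCLike.inner_apply, conj_trivial]
  ring

theorem norm_integral_mul_le {f : ℝ → ℝ} {z : ℝ → ℂ} (hf : MemLp f 2) (hz : MemLp z 2) {δ : ℝ}
    (hδ : 0 < δ) :
    ‖∫ ν, (f ν : ℂ) * z ν‖ ≤ δ⁻¹ * (∫ ν, f ν ^ 2) + δ * ∫ ν, ‖z ν‖ ^ 2 := by
  have h1 := hf.integrable_sq
  have h2 := hz.norm.integrable_sq
  rw [← integral_const_mul, ← integral_const_mul, ← integral_add (h1.const_mul _) (h2.const_mul _)]
  refine norm_integral_le_of_norm_le ((h1.const_mul _).add (h2.const_mul _))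
    (Eventually.of_forall fun ν => ?_)
  rw [norm_mul, norm_real, Real.norm_eq_abs]
  have h3 : δ⁻¹ * f ν ^ 2 + δ * ‖z ν‖ ^ 2 - |f ν| * ‖z ν‖ =
      δ⁻¹ * ((|f ν| - δ * ‖z ν‖ / 2) ^ 2 + 3 / 4 * (δ * ‖z ν‖) ^ 2) := by
    rw [← sq_abs (f ν)]
    field_simp
    ring
  have h4 : 0 ≤ δ⁻¹ * ((|f ν| - δ * ‖z ν‖ / 2) ^ 2 + 3 / 4 * (δ * ‖z ν‖) ^ 2) := by positivity
  linarith

/-- A thermostat of bounded energy whose driving velocity tends to zero disperses: its amplitudes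
tend to zero weakly in `L²`. -/
theorem tendsto_bathPairing (hk : ContinuousOn k {0}ᶜ) (hk0 : ∀ ν, ν ≠ 0 → k ν ≠ 0)
    (hkL : MemLp k 2) (hv : Continuous v) {Q : ℝ} (hQ : ∀ t, |v t| ≤ Q) (hz : MemLp z₀ 2)
    (hlim : Tendsto v atTop (𝓝 0)) {C : ℝ} (hC : ∀ t, ∫ ν, ‖bathMode k v z₀ t ν‖ ^ 2 ≤ C)
    {g : ℝ → ℝ} (hg : MemLp g 2) : Tendsto (bathPairing k v z₀ g) atTop (𝓝 0) := by
  rw [Metric.tendsto_atTop]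
  intro ε hε
  have hC0 : 0 ≤ C := (integral_nonneg fun ν => by positivity).trans (hC 0)
  set δ : ℝ := ε / (4 * (C + 1)) with hδ
  have hδpos : 0 < δ := by positivity
  obtain ⟨s, h1, h2, h3, h4⟩ := exists_smooth_div_approx hk hk0 hg
    (show 0 < δ * (ε / 4) by positivity)
  have hm := memLp_smooth_div hk hk0 h1.continuous h2 h3
  obtain ⟨T, hT⟩ := (Metric.tendsto_atTop.1 (tendsto_bathPairing_smooth_div hk hk0 hkL hv hQ hz
    hlim h1 h2 h3)) (ε / 4) (by positivity)
  refine ⟨T, fun t ht => ?_⟩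
  have h5 := hT t ht
  rw [dist_zero_right] at h5 ⊢
  have h6 : bathPairing k v z₀ g t - bathPairing k v z₀ (fun ν => s ν / k ν) t =
      ∫ ν, ((g ν - s ν / k ν : ℝ) : ℂ) * bathMode k v z₀ t ν := by
    rw [bathPairing, bathPairing, ← integral_sub (integrable_mul_bathMode hv hkL hz hg t)
      (integrable_mul_bathMode hv hkL hz hm t)]
    congr 1
    ext ν
    push_cast
    ring
  have h7 := norm_integral_mul_le (hg.sub hm) (memLp_bathMode hv hkL hz t) hδpos
  simp only [Pi.sub_apply] at h7
  rw [← h6] at h7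
  have h8 : δ⁻¹ * ∫ ν, (g ν - s ν / k ν) ^ 2 < ε / 4 := by
    rw [inv_mul_lt_iff₀ hδpos]
    exact h4
  have h9 : δ * ∫ ν, ‖bathMode k v z₀ t ν‖ ^ 2 ≤ ε / 4 := by
    calc δ * ∫ ν, ‖bathMode k v z₀ t ν‖ ^ 2 ≤ δ * (C + 1) := by
          gcongr
          linarith [hC t]
      _ = ε / 4 := by rw [hδ]; field_simp
  have h10 := norm_add_le (bathPairing k v z₀ g t - bathPairing k v z₀ (fun ν => s ν / k ν) t)
    (bathPairing k v z₀ (fun ν => s ν / k ν) t)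
  rw [sub_add_cancel] at h10
  linarith

end Bath

/-! ### The weights generated by a coupling function -/

/-- The weight `ν^i κ(ν) / ν`. The force exerted by the thermostat is the pairing with the weight
number `0`, and its `i`-th derivative involves the weight number `i`. -/
noncomputable def couplingWeight (κ : ℝ → ℝ) (i : ℕ) (ν : ℝ) : ℝ := ν ^ i * (κ ν / ν)

theorem memLp_div_id {κ : ℝ → ℝ} (hκ : ContDiff ℝ 2 κ) (h0 : κ 0 = 0) (hL : MemLp κ 2) :
    MemLp (fun ν => κ ν / ν) 2 := by
  have hmeas : AEStronglyMeasurable (fun ν => κ ν / ν) volume :=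
    (hκ.continuous.measurable.div measurable_id).aestronglyMeasurable
  obtain ⟨C, hC⟩ := (isCompact_Icc (a := (-1 : ℝ)) (b := 1)).exists_bound_of_continuousOn
    (hκ.continuous_deriv (by norm_num)).continuousOn
  have hC0 : 0 ≤ C := (norm_nonneg _).trans (hC 0 (by simp))
  have hnear : ∀ ν : ℝ, |ν| ≤ 1 → |κ ν| ≤ C * |ν| := by
    intro ν hν
    have h1 := Convex.norm_image_sub_le_of_norm_deriv_le
      (fun x _ => (hκ.differentiable (by norm_num)) x) hC (convex_Icc (-1 : ℝ) 1)
      (show (0:ℝ) ∈ Set.Icc (-1:ℝ) 1 by simp) (abs_le.1 hν)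
    simpa [h0] using h1
  have hind : MemLp ((Set.Icc (-1 : ℝ) 1).indicator fun _ => C) 2 :=
    memLp_indicator_const 2 measurableSet_Icc C (Or.inr (by simp))
  refine (hind.norm.add hL.norm).mono hmeas (Eventually.of_forall fun ν => ?_)
  simp only [Pi.add_apply, Real.norm_eq_abs]
  rw [abs_of_nonneg
    (show 0 ≤ |(Set.Icc (-1 : ℝ) 1).indicator (fun _ => C) ν| + |κ ν| by positivity)]
  by_cases hν : |ν| ≤ 1
  · rw [Set.indicator_of_mem (show ν ∈ Set.Icc (-1:ℝ) 1 from abs_le.1 hν), abs_of_nonneg hC0,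
      abs_div]
    refine le_add_of_le_of_nonneg ?_ (abs_nonneg _)
    exact div_le_of_le_mul₀ (abs_nonneg _) hC0 (hnear ν hν)
  · refine le_add_of_nonneg_of_le (abs_nonneg _) ?_
    rw [abs_div]
    exact div_le_self (abs_nonneg _) (not_le.1 hν).le

theorem memLp_couplingWeight {κ : ℝ → ℝ} (hκ : ContDiff ℝ 2 κ) (h0 : κ 0 = 0) (hL : MemLp κ 2)
    {r : ℕ} (hr : MemLp (fun ν : ℝ => ν ^ r * κ ν) 2) {i : ℕ} (hi : i ≤ r + 1) :
    MemLp (couplingWeight κ i) 2 := by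
  rcases i with _ | i
  · rw [show couplingWeight κ 0 = fun ν => κ ν / ν from funext fun ν => by simp [couplingWeight]]
    exact memLp_div_id hκ h0 hL
  · have hmeas : AEStronglyMeasurable (couplingWeight κ (i + 1)) volume :=
      ((measurable_id.pow_const _).mul
        (hκ.continuous.measurable.div measurable_id)).aestronglyMeasurable
    refine (hL.norm.add hr.norm).mono hmeas (Eventually.of_forall fun ν => ?_)
    simp only [Pi.add_apply, Real.norm_eq_abs, couplingWeight]
    rw [abs_of_nonneg (show 0 ≤ |κ ν| + |ν ^ r * κ ν| by positivity)]
    by_cases hν : ν = 0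
    · subst hν
      simp only [ne_eq, Nat.add_eq_zero_iff, one_ne_zero, and_false, not_false_eq_true, zero_pow,
        zero_mul, abs_zero]
      positivity
    · rw [show ν ^ (i + 1) * (κ ν / ν) = ν ^ i * κ ν by field_simp; ring, abs_mul, abs_mul, abs_pow,
        abs_pow]
      rcases le_total |ν| 1 with h | h
      · have : |ν| ^ i ≤ 1 := pow_le_one₀ (abs_nonneg _) h
        have h2 : 0 ≤ |ν| ^ r * |κ ν| := by positivity
        nlinarith [abs_nonneg (κ ν)]
      · have : |ν| ^ i ≤ |ν| ^ r := pow_le_pow_right₀ h (by omega)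
        nlinarith [abs_nonneg (κ ν)]

/-- The pairings of a dispersing thermostat with the coupling weights decay together with their
derivatives: each derivative is, up to a multiple of the driving velocity, the pairing with the next
weight. -/
theorem decaysToOrder_bathPairing {k v : ℝ → ℝ} {z₀ : ℝ → ℂ} {κ : ℝ → ℝ} {r : ℕ}
    (hv : Continuous v) (hk : MemLp k 2) (hz : MemLp z₀ 2)
    (hw : ∀ i ≤ r + 1, MemLp (couplingWeight κ i) 2)
    (hlim : ∀ i ≤ r + 1, Tendsto (bathPairing k v z₀ (couplingWeight κ i)) atTop (𝓝 0))
    {n i : ℕ} (hni : n + i ≤ r + 1) (hvn : ∀ m, m + 1 = n → DecaysToOrder m v) :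
    DecaysToOrder n (bathPairing k v z₀ (couplingWeight κ i)) := by
  induction n generalizing i with
  | zero =>
    exact decaysToOrder_zero.2 ⟨continuous_bathPairing hv hk hz (hw i (by omega)),
      hlim i (by omega)⟩
  | succ n ih =>
    have hd : ∀ t, HasDerivAt (bathPairing k v z₀ (couplingWeight κ i))
        (Complex.I * bathPairing k v z₀ (couplingWeight κ (i + 1)) t -
          Complex.I * (∫ ν, couplingWeight κ i ν * k ν : ℝ) * v t) t := by
      intro t
      have h1 : (fun ν => ν * couplingWeight κ i ν) = couplingWeight κ (i + 1) := by
        ext ν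
        simp only [couplingWeight]
        ring
      have h2 := hasDerivAt_bathPairing hv hk hz (hw i (by omega))
        (by rw [h1]; exact hw (i + 1) (by omega)) t
      rwa [h1] at h2
    refine decaysToOrder_succ.2 ⟨fun t => (hd t).differentiableAt, hlim i (by omega), ?_⟩
    rw [show deriv (bathPairing k v z₀ (couplingWeight κ i)) = _ from funext fun t => (hd t).deriv]
    have hvn' := hvn n rfl
    refine DecaysToOrder.sub ?_ ?_
    · exact (ih (by omega) fun m hm => hvn'.mono (by omega)).clm
        (ContinuousLinearMap.mul ℝ ℂ Complex.I)
    · exact (hvn'.clm Complex.ofRealCLM).clm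
        (ContinuousLinearMap.mul ℝ ℂ (Complex.I * (∫ ν, couplingWeight κ i ν * k ν : ℝ)))

namespace OscillatorNetwork

/-! ### The effective potential along curves -/

section

variable {𝒢 : Type*} {S : OscillatorNetwork 𝒢}

theorem deriv_V_symm (i j : 𝒢) (h : S.graph.Adj i j) (x : ℝ) :
    deriv (S.V j i) (-x) = -deriv (S.V i j) x := by
  have h1 : S.V i j = fun x => S.V j i (-x) := funext (S.V_symm i j h)
  rw [h1, deriv_comp_neg, neg_neg]

theorem SmoothPotentials.hasDerivAt_U (hA1 : S.SmoothPotentials) (j : 𝒢) (x : ℝ) :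
    HasDerivAt (S.U j) (deriv (S.U j) x) x :=
  ((hA1.1 j).differentiable (by simp) x).hasDerivAt

theorem SmoothPotentials.hasDerivAt_V (hA1 : S.SmoothPotentials) {i j : 𝒢}
    (h : S.graph.Adj i j) (x : ℝ) : HasDerivAt (S.V i j) (deriv (S.V i j) x) x :=
  ((hA1.2 i j h).1.differentiable (by simp) x).hasDerivAt

end

variable {𝒢 : Type*} [Fintype 𝒢] (S : OscillatorNetwork 𝒢)

open scoped Classical in
/-- The partial derivative `∂V^eff/∂q_j`. -/
noncomputable def effGrad (q : EuclideanSpace ℝ 𝒢) (j : 𝒢) : ℝ :=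
  deriv (S.U j) (q j) - (∑ i, if S.graph.Adj i j then deriv (S.V i j) (q i - q j) else 0)
    - if j ∈ S.Λ then S.K j * q j else 0

variable {S}

theorem hasDerivAt_Veff_comp (hA1 : S.SmoothPotentials) {c : ℝ → EuclideanSpace ℝ 𝒢} {c' : 𝒢 → ℝ}
    {t : ℝ} (hc : ∀ j, HasDerivAt (fun s => c s j) (c' j) t) :
    HasDerivAt (fun s => S.Veff (c s)) (∑ j, S.effGrad (c t) j * c' j) t := by
  classical
  have h1 : HasDerivAt (fun s => ∑ j, S.U j (c s j)) (∑ j, deriv (S.U j) (c t j) * c' j) t :=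
    HasDerivAt.fun_sum fun j _ => (hA1.hasDerivAt_U j _).comp t (hc j)
  have h2 : HasDerivAt (fun s => ∑ i, ∑ j,
      (if S.graph.Adj i j then S.V i j (c s i - c s j) else 0))
      (∑ i, ∑ j, (if S.graph.Adj i j then deriv (S.V i j) (c t i - c t j) * (c' i - c' j) else 0))
      t := by
    refine HasDerivAt.fun_sum fun i _ => HasDerivAt.fun_sum fun j _ => ?_
    by_cases h : S.graph.Adj i j
    · simp only [h, if_true]
      exact (hA1.hasDerivAt_V h _).comp t ((hc i).sub (hc j))
    · simp only [h, if_false]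
      exact hasDerivAt_const _ _
  have h3 : HasDerivAt (fun s => ∑ m ∈ S.Λ, S.K m * c s m ^ 2 / 2)
      (∑ m ∈ S.Λ, S.K m * c t m * c' m) t := by
    refine HasDerivAt.fun_sum fun m _ => ?_
    refine ((((hc m).pow 2).const_mul (S.K m)).div_const 2).congr_deriv ?_
    simp
    ring
  refine ((h1.add (h2.const_mul (1 / 2))).sub h3).congr_deriv ?_
  -- By the symmetry of the interactions both halves of the double sum agree.
  have h4 : ∑ i, ∑ j, (if S.graph.Adj i j then deriv (S.V i j) (c t i - c t j) * c' i else 0) =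
      -∑ i, ∑ j, (if S.graph.Adj i j then deriv (S.V i j) (c t i - c t j) * c' j else 0) := by
    rw [Finset.sum_comm, ← Finset.sum_neg_distrib]
    refine Finset.sum_congr rfl fun i _ => ?_
    rw [← Finset.sum_neg_distrib]
    refine Finset.sum_congr rfl fun j _ => ?_
    by_cases h : S.graph.Adj i j
    · rw [if_pos h, if_pos h.symm, show c t j - c t i = -(c t i - c t j) by ring,
        deriv_V_symm i j h]
      ring
    · rw [if_neg h, if_neg fun h' => h h'.symm, neg_zero]
  have h5 : ∑ i, ∑ j, (if S.graph.Adj i j then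
        deriv (S.V i j) (c t i - c t j) * (c' i - c' j) else 0) =
      -2 * ∑ j, (∑ i, if S.graph.Adj i j then deriv (S.V i j) (c t i - c t j) else 0) * c' j := by
    have h6 : ∀ i j, (if S.graph.Adj i j then
        deriv (S.V i j) (c t i - c t j) * (c' i - c' j) else 0) =
        (if S.graph.Adj i j then deriv (S.V i j) (c t i - c t j) * c' i else 0) -
        (if S.graph.Adj i j then deriv (S.V i j) (c t i - c t j) * c' j else 0) := by
      intro i j
      split_ifs <;> ring
    simp_rw [h6, Finset.sum_sub_distrib]
    rw [h4, Finset.sum_comm]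
    simp_rw [Finset.sum_mul, ite_mul, zero_mul]
    ring
  have h7 : ∑ m ∈ S.Λ, S.K m * c t m * c' m =
      ∑ j, (if j ∈ S.Λ then S.K j * c t j else 0) * c' j := by
    simp_rw [ite_mul, zero_mul]
    rw [Finset.sum_ite_mem, Finset.univ_inter]
  rw [h5, h7]
  simp only [effGrad, sub_mul, Finset.sum_sub_distrib]
  ring

theorem criticalSet_eq (hA1 : S.SmoothPotentials) :
    S.criticalSet = {q | ∀ j, S.effGrad q j = 0} := by
  classical
  ext q
  refine forall_congr' fun j => ?_
  have hc : ∀ i, HasDerivAt (fun s : ℝ => (q + s • EuclideanSpace.single j (1 : ℝ)) i)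
      (if i = j then 1 else 0) 0 := by
    intro i
    by_cases h : i = j
    · subst h
      simpa using (hasDerivAt_id (0 : ℝ)).const_add (q i)
    · simpa [h] using hasDerivAt_const (0 : ℝ) (q i)
  have h1 := hasDerivAt_Veff_comp hA1 hc
  have h2 : lineDeriv ℝ S.Veff q (EuclideanSpace.single j 1) = S.effGrad q j := by
    rw [lineDeriv]
    convert h1.deriv using 1
    · simp
  convert Iff.rfl using 2
  convert h2.symm

theorem continuous_Veff (hA1 : S.SmoothPotentials) : Continuous S.Veff := by
  classical
  unfold Veff
  refine ((continuous_finsetSum _ fun j _ => ?_).add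
    (continuous_const.mul (continuous_finsetSum _ fun i _ =>
      continuous_finsetSum _ fun j _ => ?_))).sub
    (continuous_finsetSum _ fun m _ => by fun_prop)
  · exact (hA1.1 j).continuous.comp (by fun_prop)
  · by_cases h : S.graph.Adj i j
    · simp only [h, if_true]
      exact (hA1.2 i j h).1.continuous.comp (by fun_prop)
    · simp only [h, if_false]
      exact continuous_const

theorem continuous_effGrad (hA1 : S.SmoothPotentials) (j : 𝒢) :
    Continuous fun q => S.effGrad q j := by
  classical
  unfold effGrad
  refine (Continuous.sub ?_ (continuous_finsetSum _ fun i _ => ?_)).sub ?_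
  · exact ((contDiff_infty_iff_deriv.1 (hA1.1 j)).2.continuous).comp (by fun_prop)
  · by_cases h : S.graph.Adj i j
    · simp only [h, if_true]
      exact ((contDiff_infty_iff_deriv.1 (hA1.2 i j h).1).2.continuous).comp (by fun_prop)
    · simp only [h, if_false]
      exact continuous_const
  · by_cases h : j ∈ S.Λ
    · simp only [h, if_true]
      fun_prop
    · simp only [h, if_false]
      exact continuous_const

theorem bddBelow_Veff (hA1 : S.SmoothPotentials) (hA3 : S.Coercive) : ∃ B, ∀ q, B ≤ S.Veff q := by
  have h1 : Tendsto S.Veff (cocompact _) atTop := by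
    rwa [← Metric.cobounded_eq_cocompact]
  obtain ⟨q, hq⟩ := (continuous_Veff hA1).exists_forall_le h1
  exact ⟨_, hq⟩

theorem Coercive.bounded_of_le (hA3 : S.Coercive) (E : ℝ) :
    ∃ N, ∀ q, S.Veff q ≤ E → ‖q‖ ≤ N := by
  have h1 : ∀ᶠ q in Bornology.cobounded (EuclideanSpace ℝ 𝒢), E < S.Veff q :=
    hA3.eventually_gt_atTop E
  have h2 : Bornology.IsBounded {q | S.Veff q ≤ E} := by
    rw [Bornology.isBounded_def]
    filter_upwards [h1] with q hq
    simpa using hq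
  obtain ⟨N, hN⟩ := h2.exists_norm_le
  exact ⟨N, fun q hq => hN q hq⟩

end OscillatorNetwork

namespace OscillatorNetwork

/-! ### Reduction to a forced system and a priori bounds -/

section

variable {𝒢 : Type*} (S : OscillatorNetwork 𝒢)

/-- The initial amplitude `ξ̇₀ + i (νξ₀ - κ q₀ / ν)` of the thermostat attached to the vertex
`m`. -/
noncomputable def initialMode (q₀ : EuclideanSpace ℝ 𝒢) (ξ₀ ξ₀' : 𝒢 → ℝ → ℝ) (m : 𝒢) (ν : ℝ) : ℂ :=
  ξ₀' m ν + Complex.I * ((ν * ξ₀ m ν - S.κ m ν / ν * q₀ m : ℝ) : ℂ)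

open scoped Classical in
/-- The part of the force of the thermostats on the vertex `j` which is not absorbed into the
effective potential, when the network moves with the velocities `v`. -/
noncomputable def residualForce (v : 𝒢 → ℝ → ℝ) (q₀ : EuclideanSpace ℝ 𝒢) (ξ₀ ξ₀' : 𝒢 → ℝ → ℝ)
    (j : 𝒢) (t : ℝ) : ℝ :=
  if j ∈ S.Λ then
    (bathPairing (fun ν => S.κ j ν / ν) (v j) (S.initialMode q₀ ξ₀ ξ₀' j)
      (fun ν => S.κ j ν / ν) t).im
  else 0

variable {S} {r : ℕ}

theorem CouplingCondition.memLp_div (hA2 : S.CouplingCondition r) {m : 𝒢} (hm : m ∈ S.Λ) :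
    MemLp (fun ν => S.κ m ν / ν) 2 :=
  memLp_div_id (hA2 m hm).1 (((hA2 m hm).2.1 0).2 rfl) (hA2 m hm).2.2.2.1

theorem CouplingCondition.continuousOn_div (hA2 : S.CouplingCondition r) {m : 𝒢} (hm : m ∈ S.Λ) :
    ContinuousOn (fun ν => S.κ m ν / ν) {0}ᶜ :=
  (hA2 m hm).1.continuous.continuousOn.div continuousOn_id fun _ h => h

theorem CouplingCondition.div_ne_zero (hA2 : S.CouplingCondition r) {m : 𝒢} (hm : m ∈ S.Λ)
    (ν : ℝ) (hν : ν ≠ 0) : S.κ m ν / ν ≠ 0 :=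
  _root_.div_ne_zero (fun h => hν (((hA2 m hm).2.1 ν).1 h)) hν

theorem ae_ne_zero : ∀ᵐ ν : ℝ, ν ≠ 0 := by
  simp [ae_iff, measure_singleton]

theorem memLp_two_of_lintegral_sq {f : ℝ → ℝ} (hf : AEMeasurable f volume)
    (h : ∫⁻ ν, ENNReal.ofReal (f ν ^ 2) < ⊤) : MemLp f 2 := by
  rw [memLp_two_iff_integrable_sq hf.aestronglyMeasurable]
  refine ⟨(hf.pow_const 2).aestronglyMeasurable, ?_⟩
  rw [hasFiniteIntegral_iff_ofReal (Eventually.of_forall fun ν => sq_nonneg _)]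
  exact h

theorem FiniteThermostatEnergy.memLp_initialMode {ξ₀ ξ₀' : 𝒢 → ℝ → ℝ}
    (hA4 : S.FiniteThermostatEnergy ξ₀ ξ₀') (hA2 : S.CouplingCondition r)
    (q₀ : EuclideanSpace ℝ 𝒢) {m : 𝒢} (hm : m ∈ S.Λ) : MemLp (S.initialMode q₀ ξ₀ ξ₀' m) 2 := by
  obtain ⟨h1, h2, h3⟩ := hA4 m hm
  unfold thermostatEnergy at h3
  have bound : ∀ f : ℝ → ℝ, (∀ ν, f ν ^ 2 ≤ ξ₀' m ν ^ 2 + ν ^ 2 * ξ₀ m ν ^ 2) →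
      ∫⁻ ν, ENNReal.ofReal (f ν ^ 2) < ⊤ := by
    intro f hf
    calc ∫⁻ ν, ENNReal.ofReal (f ν ^ 2)
        ≤ ∫⁻ ν, 2 * ENNReal.ofReal ((ξ₀' m ν ^ 2 + ν ^ 2 * ξ₀ m ν ^ 2) / 2) := by
          refine lintegral_mono fun ν => ?_
          rw [show (2 : ℝ≥0∞) = ENNReal.ofReal 2 by simp, ← ENNReal.ofReal_mul (by norm_num)]
          refine ENNReal.ofReal_le_ofReal ?_
          linarith [hf ν]
      _ = 2 * ∫⁻ ν, ENNReal.ofReal ((ξ₀' m ν ^ 2 + ν ^ 2 * ξ₀ m ν ^ 2) / 2) :=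
          lintegral_const_mul' _ _ (by simp)
      _ < ⊤ := ENNReal.mul_lt_top (by simp) h3
  have h4 : MemLp (ξ₀' m) 2 := memLp_two_of_lintegral_sq h2 (bound _ fun ν => by
    have : 0 ≤ ν ^ 2 * ξ₀ m ν ^ 2 := by positivity
    linarith)
  have h5 : MemLp (fun ν => ν * ξ₀ m ν) 2 :=
    memLp_two_of_lintegral_sq (aemeasurable_id.mul h1) (bound _ fun ν => by
      rw [mul_pow]
      linarith [sq_nonneg (ξ₀' m ν)])
  have h6 : MemLp (fun ν => ν * ξ₀ m ν - S.κ m ν / ν * q₀ m) 2 :=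
    h5.sub ((hA2.memLp_div hm).mul_const _)
  have h7 : MemLp (fun ν => (ξ₀' m ν : ℂ)) 2 := h4.ofReal
  have h8 : MemLp (fun ν => ((ν * ξ₀ m ν - S.κ m ν / ν * q₀ m : ℝ) : ℂ)) 2 := h6.ofReal
  exact h7.add (h8.const_mul Complex.I)

end

variable {𝒢 : Type*} [Fintype 𝒢] {S : OscillatorNetwork 𝒢} {r : ℕ}
  {q₀ q₀' : EuclideanSpace ℝ 𝒢} {ξ₀ ξ₀' : 𝒢 → ℝ → ℝ} {q : ℝ → EuclideanSpace ℝ 𝒢}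
  {ξ : 𝒢 → ℝ → ℝ → ℝ}

theorem IsSolution.continuous_velocity (hsol : S.IsSolution q₀ q₀' ξ₀ ξ₀' q ξ) (j : 𝒢) :
    Continuous (deriv fun s => q s j) :=
  continuous_iff_continuousAt.2 fun t => (hsol.eq_q j t).continuousAt

theorem IsSolution.hasDerivAt_q (hsol : S.IsSolution q₀ q₀' ξ₀ ξ₀' q ξ) (j : 𝒢) (t : ℝ) :
    HasDerivAt (fun s => q s j) (deriv (fun s => q s j) t) t :=
  (hsol.differentiable_q j t).hasDerivAt

theorem IsSolution.ae_mode_eq (hsol : S.IsSolution q₀ q₀' ξ₀ ξ₀' q ξ) {m : 𝒢} (hm : m ∈ S.Λ) :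
    ∀ᵐ ν : ℝ, ∀ t : ℝ, ((deriv (ξ m ν) t : ℝ) : ℂ) +
        Complex.I * ((ν * ξ m ν t - S.κ m ν / ν * q t m : ℝ) : ℂ) =
      bathMode (fun ν => S.κ m ν / ν) (deriv fun s => q s m) (S.initialMode q₀ ξ₀ ξ₀' m) t ν := by
  filter_upwards [hsol.eq_ξ m hm, hsol.init_ξ m hm, hsol.init_ξ' m hm, ae_ne_zero]
    with ν h1 h2 h3 hν t
  refine eq_bathMode (hsol.continuous_velocity m)
    (z := fun t => ((deriv (ξ m ν) t : ℝ) : ℂ) +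
      Complex.I * ((ν * ξ m ν t - S.κ m ν / ν * q t m : ℝ) : ℂ)) ?_ (fun t => ?_) t
  · simp only [initialMode, h2, h3, hsol.init_q]
  · have h4 : HasDerivAt (fun t => ν * ξ m ν t - S.κ m ν / ν * q t m)
        (ν * deriv (ξ m ν) t - S.κ m ν / ν * deriv (fun s => q s m) t) t :=
      ((h1.1 t).hasDerivAt.const_mul ν).sub ((hsol.hasDerivAt_q m t).const_mul _)
    refine ((h1.2 t).ofReal_comp.add (h4.ofReal_comp.const_mul Complex.I)).congr_deriv ?_
    have h5 : (S.κ m ν : ℂ) = ν * ((S.κ m ν / ν : ℝ) : ℂ) := by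
      rw [← Complex.ofReal_mul, mul_div_cancel₀ _ hν]
    push_cast at h5 ⊢
    have h6 : (ν : ℂ) ≠ 0 := by exact_mod_cast hν
    field_simp
    linear_combination (-(ν : ℂ) ^ 3 * ξ m ν t + ν * S.κ m ν * q t m) * Complex.I_sq

/-- The network obeys `q̈_j = -∂_j V^eff(q) + R_j`. -/
theorem IsSolution.hasDerivAt_velocity (hA2 : S.CouplingCondition r)
    (hA4 : S.FiniteThermostatEnergy ξ₀ ξ₀') (hsol : S.IsSolution q₀ q₀' ξ₀ ξ₀' q ξ)
    (j : 𝒢) (t : ℝ) :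
    HasDerivAt (deriv fun s => q s j) (-S.effGrad (q t) j +
      S.residualForce (fun j => deriv fun s => q s j) q₀ ξ₀ ξ₀' j t) t := by
  classical
  refine (hsol.eq_q j t).congr_deriv ?_
  unfold effGrad residualForce
  by_cases hj : j ∈ S.Λ
  · simp only [hj, if_true]
    have hk := hA2.memLp_div hj
    have hz := hA4.memLp_initialMode hA2 q₀ hj
    have hv := hsol.continuous_velocity j
    set k : ℝ → ℝ := fun ν => S.κ j ν / ν with hkdef
    set z := bathMode k (deriv fun s => q s j) (S.initialMode q₀ ξ₀ ξ₀' j) with hzdef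
    have hint := integrable_mul_bathMode hv hk hz hk t
    have h1 : ∫ ν, S.κ j ν * ξ j ν t =
        ∫ ν, (((k ν : ℂ) * z t ν).im + S.κ j ν ^ 2 / ν ^ 2 * q t j) := by
      refine integral_congr_ae ?_
      filter_upwards [hsol.ae_mode_eq hj, ae_ne_zero] with ν h2 hν
      rw [hzdef, ← h2 t]
      simp [hkdef]
      field_simp
      ring
    have h3 : ∀ ν, S.κ j ν ^ 2 / ν ^ 2 = k ν ^ 2 := fun ν => by rw [hkdef, div_pow]
    have h4 : Integrable fun ν => S.κ j ν ^ 2 / ν ^ 2 * q t j := by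
      simp_rw [h3]
      exact hk.integrable_sq.mul_const _
    have h5 : ∫ ν, ((k ν : ℂ) * z t ν).im = (∫ ν, (k ν : ℂ) * z t ν).im := by
      simpa only [RCLike.im_to_complex] using integral_im hint
    have h6 : Integrable fun ν => ((k ν : ℂ) * z t ν).im := by
      simpa only [RCLike.im_to_complex] using hint.im
    rw [h1, integral_add h6 h4, h5, integral_mul_const]
    simp only [bathPairing, K, hzdef]
    ring
  · simp only [hj, if_false]
    ring

/-- The energy of the network and its thermostats is conserved. -/
theorem IsSolution.energy_conserved (hA1 : S.SmoothPotentials) (hA2 : S.CouplingCondition r)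
    (hA4 : S.FiniteThermostatEnergy ξ₀ ξ₀') (hsol : S.IsSolution q₀ q₀' ξ₀ ξ₀' q ξ) :
    ∃ E, ∀ t, (∑ j, deriv (fun s => q s j) t ^ 2 / 2) + S.Veff (q t) +
      (∑ m ∈ S.Λ, (∫ ν, ‖bathMode (fun ν => S.κ m ν / ν) (deriv fun s => q s m)
        (S.initialMode q₀ ξ₀ ξ₀' m) t ν‖ ^ 2) / 2) = E := by
  classical
  set H : ℝ → ℝ := fun t => (∑ j, deriv (fun s => q s j) t ^ 2 / 2) + S.Veff (q t) +
      (∑ m ∈ S.Λ, (∫ ν, ‖bathMode (fun ν => S.κ m ν / ν) (deriv fun s => q s m)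
        (S.initialMode q₀ ξ₀ ξ₀' m) t ν‖ ^ 2) / 2) with hH
  have hd : ∀ t, HasDerivAt H 0 t := by
    intro t
    have h1 : HasDerivAt (fun t => ∑ j, deriv (fun s => q s j) t ^ 2 / 2)
        (∑ j, deriv (fun s => q s j) t * (-S.effGrad (q t) j +
          S.residualForce (fun j => deriv fun s => q s j) q₀ ξ₀ ξ₀' j t)) t := by
      refine HasDerivAt.fun_sum fun j _ => ?_
      refine (((hsol.hasDerivAt_velocity hA2 hA4 j t).pow 2).div_const 2).congr_deriv ?_
      simp
      ring
    have h2 := hasDerivAt_Veff_comp hA1 (fun j => hsol.hasDerivAt_q j t)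
    have h3 : HasDerivAt (fun t => ∑ m ∈ S.Λ,
        (∫ ν, ‖bathMode (fun ν => S.κ m ν / ν) (deriv fun s => q s m)
          (S.initialMode q₀ ξ₀ ξ₀' m) t ν‖ ^ 2) / 2)
        (∑ m ∈ S.Λ, -(deriv (fun s => q s m) t * (bathPairing (fun ν => S.κ m ν / ν)
          (deriv fun s => q s m) (S.initialMode q₀ ξ₀ ξ₀' m) (fun ν => S.κ m ν / ν) t).im)) t := by
      refine HasDerivAt.fun_sum fun m hm => ?_
      refine ((hasDerivAt_bathEnergy (hsol.continuous_velocity m) (hA2.memLp_div hm)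
        (hA4.memLp_initialMode hA2 q₀ hm) t).div_const 2).congr_deriv ?_
      ring
    refine ((h1.add h2).add h3).congr_deriv ?_
    have h4 : ∑ m ∈ S.Λ, -(deriv (fun s => q s m) t * (bathPairing (fun ν => S.κ m ν / ν)
          (deriv fun s => q s m) (S.initialMode q₀ ξ₀ ξ₀' m) (fun ν => S.κ m ν / ν) t).im) =
        ∑ j, -(deriv (fun s => q s j) t *
          S.residualForce (fun j => deriv fun s => q s j) q₀ ξ₀ ξ₀' j t) := by
      have h5 : ∀ j, -(deriv (fun s => q s j) t *
          S.residualForce (fun j => deriv fun s => q s j) q₀ ξ₀ ξ₀' j t) =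
          if j ∈ S.Λ then -(deriv (fun s => q s j) t * (bathPairing (fun ν => S.κ j ν / ν)
            (deriv fun s => q s j) (S.initialMode q₀ ξ₀ ξ₀' j) (fun ν => S.κ j ν / ν) t).im)
          else 0 := by
        intro j
        unfold residualForce
        split_ifs <;> simp
      rw [Finset.sum_congr rfl fun j _ => h5 j, Finset.sum_ite_mem, Finset.univ_inter]
    rw [h4, ← Finset.sum_add_distrib, ← Finset.sum_add_distrib]
    refine Finset.sum_eq_zero fun j _ => ?_
    ring
  refine ⟨H 0, fun t => ?_⟩
  exact is_const_of_deriv_eq_zero (fun t => (hd t).differentiableAt) (fun t => (hd t).deriv) t 0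

/-- Along a solution, the positions and velocities of the network and the energies of the
thermostats are bounded. -/
theorem IsSolution.bounded (hA1 : S.SmoothPotentials) (hA2 : S.CouplingCondition r)
    (hA3 : S.Coercive) (hA4 : S.FiniteThermostatEnergy ξ₀ ξ₀')
    (hsol : S.IsSolution q₀ q₀' ξ₀ ξ₀' q ξ) :
    ∃ B, ∀ t, ‖q t‖ ≤ B ∧ (∀ j, |deriv (fun s => q s j) t| ≤ B) ∧
      ∀ m ∈ S.Λ, ∫ ν, ‖bathMode (fun ν => S.κ m ν / ν) (deriv fun s => q s m)
        (S.initialMode q₀ ξ₀ ξ₀' m) t ν‖ ^ 2 ≤ B := by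
  obtain ⟨E, hE⟩ := hsol.energy_conserved hA1 hA2 hA4
  obtain ⟨b, hb⟩ := bddBelow_Veff hA1 hA3
  obtain ⟨N, hN⟩ := hA3.bounded_of_le E
  have hkin : ∀ t j, 0 ≤ deriv (fun s => q s j) t ^ 2 / 2 := fun t j => by positivity
  have hbath : ∀ t m, 0 ≤ (∫ ν, ‖bathMode (fun ν => S.κ m ν / ν) (deriv fun s => q s m)
        (S.initialMode q₀ ξ₀ ξ₀' m) t ν‖ ^ 2) / 2 := fun t m =>
    div_nonneg (integral_nonneg fun ν => by positivity) (by norm_num)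
  refine ⟨max N (max √(2 * (E - b)) (2 * (E - b))), fun t => ⟨?_, fun j => ?_, fun m hm => ?_⟩⟩
  · refine (hN _ ?_).trans (le_max_left _ _)
    have h1 := Finset.sum_nonneg fun j (_ : j ∈ Finset.univ) => hkin t j
    have h2 := Finset.sum_nonneg fun m (_ : m ∈ S.Λ) => hbath t m
    linarith [hE t]
  · refine le_max_of_le_right (le_max_of_le_left (Real.abs_le_sqrt ?_))
    have h1 := Finset.single_le_sum (fun j _ => hkin t j) (Finset.mem_univ j)
    have h2 := Finset.sum_nonneg fun m (_ : m ∈ S.Λ) => hbath t m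
    linarith [hE t, hb (q t)]
  · refine le_max_of_le_right (le_max_of_le_right ?_)
    have h1 := Finset.sum_nonneg fun j (_ : j ∈ Finset.univ) => hkin t j
    have h2 := Finset.single_le_sum (fun m _ => hbath t m) hm
    linarith [hE t, hb (q t)]

end OscillatorNetwork

theorem exists_lipschitz_of_isBigO_deriv {f f' : ℝ → ℝ} (hf : ∀ t, HasDerivAt f (f' t) t)
    (hf' : f' =O[⊤] (fun _ => (1 : ℝ))) : ∃ L, ∀ s t, |f s - f t| ≤ L * |s - t| := by
  obtain ⟨C, hC⟩ := Asymptotics.isBigO_top.1 hf'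
  exact ⟨C, lipschitz_bound_of_deriv_bound hf fun t => by simpa using hC t⟩

theorem tendsto_zero_of_isBigO_mul {f g : ℝ → ℝ} (hf : f =O[⊤] (fun _ => (1 : ℝ)))
    (hg : Tendsto g atTop (𝓝 0)) : Tendsto (fun t => f t * g t) atTop (𝓝 0) := by
  have := (hf.mono (le_top (a := atTop))).mul_isLittleO ((Asymptotics.isLittleO_one_iff ℝ).2 hg)
  simpa [Asymptotics.isLittleO_one_iff] using this

namespace OscillatorNetwork

variable {𝒢 : Type*} [Fintype 𝒢] {S : OscillatorNetwork 𝒢}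

/-! ### Propagation of relaxation through the network -/

open scoped Classical in
theorem hasDerivAt_effGrad (hA1 : S.SmoothPotentials) {q : ℝ → EuclideanSpace ℝ 𝒢}
    {v : 𝒢 → ℝ → ℝ} (hq : ∀ j t, HasDerivAt (fun s => q s j) (v j t) t) (j : 𝒢) (t : ℝ) :
    HasDerivAt (fun t => S.effGrad (q t) j)
      (deriv (deriv (S.U j)) (q t j) * v j t
        - (∑ i, if S.graph.Adj i j then
            deriv (deriv (S.V i j)) (q t i - q t j) * (v i t - v j t) else 0)
        - if j ∈ S.Λ then S.K j * v j t else 0) t := by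
  unfold effGrad
  refine (HasDerivAt.sub ?_ (HasDerivAt.fun_sum fun i _ => ?_)).sub ?_
  · exact (((contDiff_infty_iff_deriv.1 (hA1.1 j)).2.differentiable (by simp) _).hasDerivAt).comp t
      (hq j t)
  · by_cases h : S.graph.Adj i j
    · simp only [h, if_true]
      exact (((contDiff_infty_iff_deriv.1 (hA1.2 i j h).1).2.differentiable
        (by simp) _).hasDerivAt).comp t ((hq i t).sub (hq j t))
    · simp only [h, if_false]
      exact hasDerivAt_const _ _
  · by_cases h : j ∈ S.Λ
    · simp only [h, if_true]
      exact (hq j t).const_mul _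
    · simp only [h, if_false]
      exact hasDerivAt_const _ _

section Propagation

variable {q : ℝ → EuclideanSpace ℝ 𝒢} {v R : 𝒢 → ℝ → ℝ} {B : ℝ}

theorem isBigO_coord (hqB : ∀ t, ‖q t‖ ≤ B) (j : 𝒢) :
    (fun t => q t j) =O[⊤] (fun _ => (1 : ℝ)) :=
  Asymptotics.isBigO_top.2 ⟨B, fun t => by
    simpa using (PiLp.norm_apply_le (q t) j).trans (hqB t)⟩

theorem isBigO_effGrad (hA1 : S.SmoothPotentials) (hqB : ∀ t, ‖q t‖ ≤ B) (j : 𝒢) :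
    (fun t => S.effGrad (q t) j) =O[⊤] (fun _ => (1 : ℝ)) := by
  obtain ⟨C, hC⟩ := (isCompact_closedBall (0 : EuclideanSpace ℝ 𝒢) B).exists_bound_of_continuousOn
    (continuous_effGrad hA1 j).continuousOn
  exact Asymptotics.isBigO_top.2 ⟨C, fun t => by
    simpa using hC (q t) (by simpa using hqB t)⟩

theorem exists_lipschitz_effGrad (hA1 : S.SmoothPotentials)
    (hq : ∀ j t, HasDerivAt (fun s => q s j) (v j t) t) (hqB : ∀ t, ‖q t‖ ≤ B)
    (hvB : ∀ j, v j =O[⊤] (fun _ => (1 : ℝ))) (j : 𝒢) :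
    ∃ L, ∀ s t, |S.effGrad (q s) j - S.effGrad (q t) j| ≤ L * |s - t| := by
  classical
  have hmul : ∀ {f g : ℝ → ℝ}, f =O[⊤] (fun _ => (1 : ℝ)) → g =O[⊤] (fun _ => (1 : ℝ)) →
      (fun t => f t * g t) =O[⊤] (fun _ => (1 : ℝ)) := fun hf hg => by simpa using hf.mul hg
  refine exists_lipschitz_of_isBigO_deriv (hasDerivAt_effGrad hA1 hq j) ?_
  refine Asymptotics.IsBigO.sub (Asymptotics.IsBigO.sub ?_
    (Asymptotics.IsBigO.fun_sum fun i _ => ?_)) ?_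
  · exact hmul (isBigO_one_comp (contDiff_infty_iff_deriv.1
      (contDiff_infty_iff_deriv.1 (hA1.1 j)).2).2.continuous (isBigO_coord hqB j)) (hvB j)
  · by_cases h : S.graph.Adj i j
    · simp only [h, if_true]
      exact hmul (isBigO_one_comp (contDiff_infty_iff_deriv.1
        (contDiff_infty_iff_deriv.1 (hA1.2 i j h).1).2).2.continuous
        ((isBigO_coord hqB i).sub (isBigO_coord hqB j))) ((hvB i).sub (hvB j))
    · simp only [h, if_false]
      exact Asymptotics.isBigO_zero _ _
  · by_cases h : j ∈ S.Λ
    · simp only [h, if_true]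
      exact (hvB j).const_mul_left _
    · simp only [h, if_false]
      exact Asymptotics.isBigO_zero _ _

/-- At a vertex which comes to rest the effective force vanishes asymptotically. -/
theorem tendsto_effGrad_of_tendsto_velocity (hA1 : S.SmoothPotentials)
    (hq : ∀ j t, HasDerivAt (fun s => q s j) (v j t) t)
    (hv : ∀ j t, HasDerivAt (v j) (-S.effGrad (q t) j + R j t) t) (hqB : ∀ t, ‖q t‖ ≤ B)
    (hvB : ∀ j, v j =O[⊤] (fun _ => (1 : ℝ))) (hR : ∀ j, Tendsto (R j) atTop (𝓝 0)) {j : 𝒢}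
    (hj : Tendsto (v j) atTop (𝓝 0)) : Tendsto (fun t => S.effGrad (q t) j) atTop (𝓝 0) := by
  obtain ⟨L, hL⟩ := exists_lipschitz_effGrad hA1 hq hqB hvB j
  have h1 := tendsto_zero_of_increments (f := v j) (g := fun t => -S.effGrad (q t) j) (h := R j)
    (hv j) (fun s t => by
      have := hL s t
      rw [← abs_neg] at this
      convert this using 2
      ring) (hR j) fun τ _ => tendsto_increment_zero_of_tendsto_zero hj τ
  simpa using h1.neg

/-- If `j` and all its neighbours except possibly `n` come to rest, so does `n`: the effective force
at `j` tends to zero, hence so does the remaining part `V_nj''(q_n - q_j) (q̇_n - q̇_j)` of its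
derivative, and `V_nj''` has only isolated zeros. -/
theorem tendsto_velocity_of_neighbours (hA1 : S.SmoothPotentials)
    (hq : ∀ j t, HasDerivAt (fun s => q s j) (v j t) t)
    (hv : ∀ j t, HasDerivAt (v j) (-S.effGrad (q t) j + R j t) t) (hqB : ∀ t, ‖q t‖ ≤ B)
    (hvB : ∀ j, v j =O[⊤] (fun _ => (1 : ℝ))) (hRB : ∀ j, R j =O[⊤] (fun _ => (1 : ℝ)))
    (hR : ∀ j, Tendsto (R j) atTop (𝓝 0)) {j n : 𝒢} (hnj : S.graph.Adj n j)
    (hj : Tendsto (v j) atTop (𝓝 0))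
    (hnb : ∀ i, i ≠ n → S.graph.Adj i j → Tendsto (v i) atTop (𝓝 0)) :
    Tendsto (v n) atTop (𝓝 0) := by
  classical
  have hmul : ∀ {f g : ℝ → ℝ}, f =O[⊤] (fun _ => (1 : ℝ)) → g =O[⊤] (fun _ => (1 : ℝ)) →
      (fun t => f t * g t) =O[⊤] (fun _ => (1 : ℝ)) := fun hf hg => by simpa using hf.mul hg
  have hV2 : ∀ i, S.graph.Adj i j → ContDiff ℝ ((⊤ : ℕ∞) : WithTop ℕ∞) (deriv (deriv (S.V i j))) :=
    fun i h => (contDiff_infty_iff_deriv.1 (contDiff_infty_iff_deriv.1 (hA1.2 i j h).1).2).2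
  have hV3 := contDiff_infty_iff_deriv.1 (hV2 n hnj)
  have hxO : ∀ i, (fun t => q t i - q t j) =O[⊤] (fun _ => (1 : ℝ)) := fun i =>
    (isBigO_coord hqB i).sub (isBigO_coord hqB j)
  have haO : ∀ i, (fun t => -S.effGrad (q t) i + R i t) =O[⊤] (fun _ => (1 : ℝ)) := fun i =>
    (isBigO_effGrad hA1 hqB i).neg_left.add (hRB i)
  have hx : ∀ t, HasDerivAt (fun t => q t n - q t j) (v n t - v j t) t := fun t =>
    (hq n t).sub (hq j t)
  have hy : ∀ t, HasDerivAt (fun t => v n t - v j t)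
      ((-S.effGrad (q t) n + R n t) - (-S.effGrad (q t) j + R j t)) t := fun t =>
    (hv n t).sub (hv j t)
  set W : ℝ → ℝ := deriv (deriv (S.V n j)) with hW
  have hWx : ∀ t, HasDerivAt (fun t => W (q t n - q t j))
      (deriv W (q t n - q t j) * (v n t - v j t)) t := fun t =>
    ((hV3.1 _).hasDerivAt).comp t (hx t)
  have hWO : (fun t => W (q t n - q t j)) =O[⊤] (fun _ => (1 : ℝ)) :=
    isBigO_one_comp (hV2 n hnj).continuous (hxO n)
  have hyO : (fun t => v n t - v j t) =O[⊤] (fun _ => (1 : ℝ)) := (hvB n).sub (hvB j)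
  obtain ⟨L, hL⟩ := exists_lipschitz_of_isBigO_deriv (fun t => (hWx t).mul (hy t))
    ((hmul (hmul (isBigO_one_comp hV3.2.continuous (hxO n)) hyO) hyO).add
      (hmul hWO ((haO n).sub (haO j))))
  obtain ⟨L', hL'⟩ := exists_lipschitz_of_isBigO_deriv hy ((haO n).sub (haO j))
  have hWy : Tendsto (fun t => W (q t n - q t j) * (v n t - v j t)) atTop (𝓝 0) := by
    have hf := tendsto_effGrad_of_tendsto_velocity hA1 hq hv hqB hvB hR hj
    have h1 := tendsto_zero_of_increments (f := fun t => S.effGrad (q t) j)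
      (g := fun t => -(W (q t n - q t j) * (v n t - v j t)))
      (h := fun t => deriv (deriv (S.U j)) (q t j) * v j t
        - (∑ i ∈ Finset.univ.erase n, if S.graph.Adj i j then
            deriv (deriv (S.V i j)) (q t i - q t j) * (v i t - v j t) else 0)
        - if j ∈ S.Λ then S.K j * v j t else 0) (L := L) (fun t => ?_) (fun s t => ?_) ?_
        fun τ _ => tendsto_increment_zero_of_tendsto_zero hf τ
    · simpa using h1.neg
    · refine (hasDerivAt_effGrad hA1 hq j t).congr_deriv ?_
      rw [← Finset.add_sum_erase _ _ (Finset.mem_univ n), if_pos hnj]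
      ring
    · have := hL s t
      rw [← abs_neg] at this
      convert this using 2
      simp only [Pi.mul_apply]
      ring
    · have hsub : ∀ {f g : ℝ → ℝ}, Tendsto f atTop (𝓝 0) → Tendsto g atTop (𝓝 0) →
          Tendsto (fun t => f t - g t) atTop (𝓝 0) := fun hf hg => by simpa using hf.sub hg
      have hsum : ∀ (s : Finset 𝒢) (f : 𝒢 → ℝ → ℝ), (∀ i ∈ s, Tendsto (f i) atTop (𝓝 0)) →
          Tendsto (fun t => ∑ i ∈ s, f i t) atTop (𝓝 0) := fun s f hf => by
        simpa using tendsto_finsetSum s hf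
      refine hsub (hsub ?_ (hsum _ _ fun i hi => ?_)) ?_
      · exact tendsto_zero_of_isBigO_mul (isBigO_one_comp (contDiff_infty_iff_deriv.1
          (contDiff_infty_iff_deriv.1 (hA1.1 j)).2).2.continuous (isBigO_coord hqB j)) hj
      · by_cases h : S.graph.Adj i j
        · simp only [h, if_true]
          refine tendsto_zero_of_isBigO_mul (isBigO_one_comp (hV2 i h).continuous (hxO i)) ?_
          simpa using (hnb i (Finset.ne_of_mem_erase hi) h).sub hj
        · simp only [h, if_false]
          exact tendsto_const_nhds
      · by_cases h : j ∈ S.Λ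
        · simp only [h, if_true]
          simpa using hj.const_mul (S.K j)
        · simp only [h, if_false]
          exact tendsto_const_nhds
  obtain ⟨M, hM⟩ := Asymptotics.isBigO_top.1 (hxO n)
  have h2 := tendsto_zero_of_mul_isolated_zeros (hV2 n hnj).continuous (hA1.2 n j hnj).2 hx
    (fun t => by simpa using hM t) hL' hWy
  simpa using h2.add hj

/-- If the thermostated vertices come to rest, then so does the whole network. -/
theorem tendsto_velocity_of_controllable (hA1 : S.SmoothPotentials) (hA5 : S.Controllable)
    (hq : ∀ j t, HasDerivAt (fun s => q s j) (v j t) t)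
    (hv : ∀ j t, HasDerivAt (v j) (-S.effGrad (q t) j + R j t) t) (hqB : ∀ t, ‖q t‖ ≤ B)
    (hvB : ∀ j, v j =O[⊤] (fun _ => (1 : ℝ))) (hRB : ∀ j, R j =O[⊤] (fun _ => (1 : ℝ)))
    (hR : ∀ j, Tendsto (R j) atTop (𝓝 0)) (hΛ : ∀ m ∈ S.Λ, Tendsto (v m) atTop (𝓝 0)) (j : 𝒢) :
    Tendsto (v j) atTop (𝓝 0) := by
  have step : ∀ k : ℕ, ∀ n ∈ (controlStep S.graph)^[k] (S.Λ : Set 𝒢),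
      Tendsto (v n) atTop (𝓝 0) := by
    intro k
    induction k with
    | zero => exact fun n hn => hΛ n (by simpa using hn)
    | succ k ih =>
      intro n hn
      rw [Function.iterate_succ_apply'] at hn
      rcases hn with hn | ⟨j, hj, ⟨_, hjn⟩, huniq⟩
      · exact ih n hn
      · refine tendsto_velocity_of_neighbours hA1 hq hv hqB hvB hRB hR hjn.symm (ih j hj)
          fun i hin hij => ih i ?_
        by_contra hi
        exact hin (huniq i ⟨hi, hij.symm⟩)
  have hj : j ∈ controlClosure S.graph (S.Λ : Set 𝒢) := by
    rw [show controlClosure S.graph (S.Λ : Set 𝒢) = Set.univ from hA5]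
    trivial
  obtain ⟨k, hk⟩ := Set.mem_iUnion.1 hj
  exact step k j hk

end Propagation

/-! ### Relaxation in the future and in the past -/

theorem slowToOrder_effGrad (hA1 : S.SmoothPotentials) {q : ℝ → EuclideanSpace ℝ 𝒢} {n : ℕ}
    (hq : ∀ j, SlowToOrder n fun t => q t j) (j : 𝒢) :
    SlowToOrder n fun t => S.effGrad (q t) j := by
  classical
  unfold effGrad
  refine (SlowToOrder.sub ?_ (SlowToOrder.sum _ fun i _ => ?_)).sub ?_
  · exact (hq j).comp_smooth (contDiff_infty_iff_deriv.1 (hA1.1 j)).2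
  · by_cases h : S.graph.Adj i j
    · simp only [h, if_true]
      exact ((hq i).sub (hq j)).comp_smooth (contDiff_infty_iff_deriv.1 (hA1.2 i j h).1).2
    · simp only [h, if_false]
      exact SlowToOrder.const _ _
  · by_cases h : j ∈ S.Λ
    · simp only [h, if_true]
      exact (hq j).comp_smooth (φ := fun x => S.K j * x) (by fun_prop)
    · simp only [h, if_false]
      exact SlowToOrder.const _ _

variable {r : ℕ} {q₀ q₀' : EuclideanSpace ℝ 𝒢} {ξ₀ ξ₀' : 𝒢 → ℝ → ℝ} {q : ℝ → EuclideanSpace ℝ 𝒢}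
  {ξ : 𝒢 → ℝ → ℝ → ℝ}

theorem IsSolution.hasDerivAt (hsol : S.IsSolution q₀ q₀' ξ₀ ξ₀' q ξ) (t : ℝ) :
    HasDerivAt q (WithLp.toLp 2 fun j => deriv (fun s => q s j) t) t := by
  rw [hasDerivAt_iff_hasFDerivAt, ← hasFDerivWithinAt_univ, hasFDerivWithinAt_euclidean]
  intro j
  rw [hasFDerivWithinAt_univ]
  refine (hsol.hasDerivAt_q j t).hasFDerivAt.congr_fderiv ?_
  ext
  simp

theorem IsSolution.relaxes_atTop (hA1 : S.SmoothPotentials) (hA2 : S.CouplingCondition r)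
    (hA3 : S.Coercive) (hA4 : S.FiniteThermostatEnergy ξ₀ ξ₀') (hA5 : S.Controllable)
    (hsol : S.IsSolution q₀ q₀' ξ₀ ξ₀' q ξ) :
    (∃ c ∈ S.criticalSet, Tendsto
      (fun t => Metric.infDist (q t) (connectedComponentIn S.criticalSet c)) atTop (𝓝 0)) ∧
    ContDiff ℝ ((r + 3 : ℕ) : WithTop ℕ∞) q ∧
    ∀ l : ℕ, 1 ≤ l → l ≤ r + 3 → Tendsto (iteratedDeriv l q) atTop (𝓝 0) := by
  classical
  obtain ⟨B, hB⟩ := hsol.bounded hA1 hA2 hA3 hA4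
  set v : 𝒢 → ℝ → ℝ := fun j => deriv fun s => q s j with hvdef
  set R : 𝒢 → ℝ → ℝ := S.residualForce v q₀ ξ₀ ξ₀' with hRdef
  have hq : ∀ j t, HasDerivAt (fun s => q s j) (v j t) t := hsol.hasDerivAt_q
  have hv : ∀ j t, HasDerivAt (v j) (-S.effGrad (q t) j + R j t) t :=
    hsol.hasDerivAt_velocity hA2 hA4
  have hvc : ∀ j, Continuous (v j) := hsol.continuous_velocity
  have hqB : ∀ t, ‖q t‖ ≤ B := fun t => (hB t).1
  have hvB : ∀ j t, |v j t| ≤ B := fun j t => (hB t).2.1 j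
  have hbath : ∀ m ∈ S.Λ, ∀ t, ∫ ν, ‖bathMode (fun ν => S.κ m ν / ν) (v m)
      (S.initialMode q₀ ξ₀ ξ₀' m) t ν‖ ^ 2 ≤ B := fun m hm t => (hB t).2.2 m hm
  have hvO : ∀ j, v j =O[⊤] (fun _ => (1 : ℝ)) := fun j =>
    Asymptotics.isBigO_top.2 ⟨B, fun t => by simpa using hvB j t⟩
  have hRO : ∀ j, R j =O[⊤] (fun _ => (1 : ℝ)) := by
    intro j
    by_cases hj : j ∈ S.Λ
    · have hk := hA2.memLp_div hj
      refine Asymptotics.isBigO_top.2 ⟨(∫ ν, (S.κ j ν / ν) ^ 2) + B, fun t => ?_⟩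
      rw [hRdef, residualForce, if_pos hj, norm_one, mul_one]
      refine (Complex.abs_im_le_norm _).trans ?_
      have h1 := norm_integral_mul_le hk
        (memLp_bathMode (hvc j) hk (hA4.memLp_initialMode hA2 q₀ hj) t) one_pos
      rw [inv_one, one_mul, one_mul] at h1
      exact h1.trans (by gcongr; exact hbath j hj t)
    · rw [show R j = fun _ => 0 from funext fun t => by rw [hRdef, residualForce, if_neg hj]]
      exact Asymptotics.isBigO_zero _ _
  -- The thermostated vertices come to rest, since otherwise they would radiate infinite energy.
  have hΛ : ∀ m ∈ S.Λ, Tendsto (v m) atTop (𝓝 0) := by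
    intro m hm
    have hk := hA2.memLp_div hm
    have hz := hA4.memLp_initialMode hA2 q₀ hm
    obtain ⟨L, hL⟩ := exists_lipschitz_of_isBigO_deriv (hv m)
      ((isBigO_effGrad hA1 hqB m).neg_left.add (hRO m))
    have hrad := weighted_fourier_bounded (hvc m) hk hz (hbath m hm)
    exact tendsto_zero_of_weighted_fourier_bounded (hA2.continuousOn_div hm) (hA2.div_ne_zero hm)
      (hvc m) (hvB m) hL (hq m) (fun t => (PiLp.norm_apply_le (q t) m).trans (hqB t))
      (fun T _ => (hrad T).1) (fun T _ => (hrad T).2)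
  have hpair : ∀ m ∈ S.Λ, ∀ g : ℝ → ℝ, MemLp g 2 → Tendsto (bathPairing (fun ν => S.κ m ν / ν)
      (v m) (S.initialMode q₀ ξ₀ ξ₀' m) g) atTop (𝓝 0) := fun m hm g hg =>
    tendsto_bathPairing (hA2.continuousOn_div hm) (hA2.div_ne_zero hm) (hA2.memLp_div hm) (hvc m)
      (hvB m) (hA4.memLp_initialMode hA2 q₀ hm) (hΛ m hm) (hbath m hm) hg
  have hR : ∀ j, Tendsto (R j) atTop (𝓝 0) := by
    intro j
    by_cases hj : j ∈ S.Λ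
    · rw [show R j = fun t => Complex.im _ from
        funext fun t => by rw [hRdef, residualForce, if_pos hj]]
      exact (Complex.continuous_im.tendsto 0).comp (hpair j hj _ (hA2.memLp_div hj))
    · rw [show R j = fun _ => 0 from funext fun t => by rw [hRdef, residualForce, if_neg hj]]
      exact tendsto_const_nhds
  have hv0 := tendsto_velocity_of_controllable hA1 hA5 hq hv hqB hvO hRO hR hΛ
  have hG0 : ∀ j, Tendsto (fun t => S.effGrad (q t) j) atTop (𝓝 0) := fun j =>
    tendsto_effGrad_of_tendsto_velocity hA1 hq hv hqB hvO hR (hv0 j)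
  have hqcont : Continuous q :=
    continuous_iff_continuousAt.2 fun t => (hsol.hasDerivAt t).continuousAt
  refine ⟨exists_connectedComponentIn_tendsto_infDist hqcont hqB fun x hx => ?_, ?_⟩
  · rw [criticalSet_eq hA1]
    intro j
    by_contra hne
    have h1 : ∀ᶠ y in 𝓝 x, |S.effGrad x j| / 2 < |S.effGrad y j| :=
      (continuous_effGrad hA1 j).abs.continuousAt.eventually_const_lt
        (half_lt_self (abs_pos.2 hne))
    have h2 : ∀ᶠ t in atTop, |S.effGrad (q t) j| < |S.effGrad x j| / 2 := by
      have := (hG0 j).abs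
      rw [abs_zero] at this
      exact this.eventually_lt_const (half_pos (abs_pos.2 hne))
    obtain ⟨t, h3, h4⟩ := ((mapClusterPt_iff_frequently.1 hx _ h1).and_eventually h2).exists
    exact lt_asymm h3 h4
  -- Each differentiation of the equation of motion gains one order of decay, as long as the
  -- coupling weights are square integrable.
  have hslow : ∀ n ≤ r + 2, ∀ j, SlowToOrder (n + 1) fun t => q t j := by
    have hboot : ∀ n ≤ r + 1, (∀ j, SlowToOrder n fun t => q t j) →
        ∀ j, SlowToOrder (n + 2) fun t => q t j := by
      intro n hn hqn j
      have hdv : deriv (v j) = fun t => -S.effGrad (q t) j + R j t := funext fun t => (hv j t).deriv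
      have hRn : DecaysToOrder n (R j) := by
        by_cases hj : j ∈ S.Λ
        · have h1 := decaysToOrder_bathPairing (κ := S.κ j) (r := r) (n := n) (i := 0) (hvc j)
            (hA2.memLp_div hj) (hA4.memLp_initialMode hA2 q₀ hj)
            (fun i hi => memLp_couplingWeight (hA2 j hj).1 (((hA2 j hj).2.1 0).2 rfl)
              (hA2 j hj).2.2.2.1 (hA2 j hj).2.2.2.2.2.2.1 hi)
            (fun i hi => hpair j hj _ (memLp_couplingWeight (hA2 j hj).1
              (((hA2 j hj).2.1 0).2 rfl) (hA2 j hj).2.2.2.1 (hA2 j hj).2.2.2.2.2.2.1 hi))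
            (by omega) (fun m hm => by
              have := hqn j
              rw [← hm] at this
              exact (slowToOrder_succ.1 this).2.2)
          rw [show couplingWeight (S.κ j) 0 = fun ν => S.κ j ν / ν from
            funext fun ν => by simp [couplingWeight]] at h1
          rw [show R j = fun t => Complex.im _ from
            funext fun t => by rw [hRdef, residualForce, if_pos hj]]
          exact h1.clm Complex.imCLM
        · rw [show R j = fun _ => 0 from funext fun t => by rw [hRdef, residualForce, if_neg hj]]
          exact decaysToOrder_const_zero n
      have hGn := (slowToOrder_effGrad hA1 hqn j).decaysToOrder (hG0 j)
      refine slowToOrder_succ.2 ⟨hsol.differentiable_q j,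
        (isBigO_coord hqB j).mono le_top, decaysToOrder_succ.2
          ⟨fun t => (hv j t).differentiableAt, hv0 j, ?_⟩⟩
      change DecaysToOrder n (deriv (v j))
      rw [hdv]
      exact hGn.neg.add hRn
    have hlow : ∀ n ≤ r + 1, ∀ j, SlowToOrder n fun t => q t j := by
      intro n
      induction n with
      | zero =>
        intro _ j
        exact slowToOrder_zero.2 ⟨(hsol.differentiable_q j).continuous,
          (isBigO_coord hqB j).mono le_top⟩
      | succ n ih =>
        intro hn j
        exact (hboot n (by omega) (ih (by omega)) j).mono (by omega)
    intro n hn j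
    exact (hboot (r + 1) le_rfl (hlow (r + 1) le_rfl) j).mono (by omega)
  have hdq : DecaysToOrder (r + 2) (deriv q) := by
    have h1 : deriv q = fun t => ∑ j, ((ContinuousLinearMap.id ℝ ℝ).smulRight
        (EuclideanSpace.single j (1 : ℝ))) (v j t) := by
      ext t i
      rw [(hsol.hasDerivAt t).deriv]
      simp [hvdef, Pi.single_apply]
    rw [h1]
    exact DecaysToOrder.sum _ fun j _ => (slowToOrder_succ.1 (hslow (r + 2) le_rfl j)).2.2.clm _
  refine ⟨contDiff_euclidean.2 fun j => (hslow (r + 2) le_rfl j).1, fun l hl1 hl => ?_⟩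
  obtain ⟨l, rfl⟩ := Nat.exists_eq_add_of_le' hl1
  rw [iteratedDeriv_succ']
  exact hdq.2 l (by omega)

/-- The equations of motion are invariant under time reversal. -/
theorem IsSolution.reverse (hsol : S.IsSolution q₀ q₀' ξ₀ ξ₀' q ξ) :
    S.IsSolution q₀ (-q₀') ξ₀ (fun m ν => -ξ₀' m ν) (fun t => q (-t))
      (fun m ν t => ξ m ν (-t)) := by
  classical
  have hd : ∀ (f : ℝ → ℝ), deriv (fun s => f (-s)) = fun s => -deriv f (-s) := fun f =>
    funext fun s => deriv_comp_neg f s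
  have hdd : ∀ {f : ℝ → ℝ} {a t : ℝ}, HasDerivAt (deriv f) a (-t) →
      HasDerivAt (deriv fun s => f (-s)) a t := by
    intro f a t h
    rw [hd]
    have h1 : HasDerivAt (fun s => deriv f (-s)) (a * -1) t := h.comp t (hasDerivAt_neg t)
    exact h1.neg.congr_deriv (by ring)
  refine ⟨fun j => ?_, fun j t => ?_, fun m hm => ?_, ?_, fun j => ?_, fun m hm => ?_,
    fun m hm => ?_⟩
  · exact (hsol.differentiable_q j).comp differentiable_neg
  · exact hdd (f := fun s => q s j) (hsol.eq_q j (-t))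
  · filter_upwards [hsol.eq_ξ m hm] with ν h
    exact ⟨h.1.comp differentiable_neg, fun t => hdd (h.2 (-t))⟩
  · simpa using hsol.init_q
  · rw [hd fun s => q s j]
    simpa using hsol.init_q' j
  · filter_upwards [hsol.init_ξ m hm] with ν h
    simpa using h
  · filter_upwards [hsol.init_ξ' m hm] with ν h
    rw [hd]
    simpa using h

end OscillatorNetwork

theorem mainTheorem1 {𝒢 : Type*} [Fintype 𝒢] (S : OscillatorNetwork 𝒢) (r : ℕ)
    (hA1 : S.SmoothPotentials) (hA2 : S.CouplingCondition r) (hA3 : S.Coercive)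
    (q₀ q₀' : EuclideanSpace ℝ 𝒢) (ξ₀ ξ₀' : 𝒢 → ℝ → ℝ)
    (hA4 : S.FiniteThermostatEnergy ξ₀ ξ₀') (hA5 : S.Controllable)
    (q : ℝ → EuclideanSpace ℝ 𝒢) (ξ : 𝒢 → ℝ → ℝ → ℝ)
    (hsol : S.IsSolution q₀ q₀' ξ₀ ξ₀' q ξ) :
    (∃ c ∈ S.criticalSet, Tendsto
      (fun t => Metric.infDist (q t) (connectedComponentIn S.criticalSet c)) atTop (𝓝 0)) ∧
    (∃ c ∈ S.criticalSet, Tendsto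
      (fun t => Metric.infDist (q t) (connectedComponentIn S.criticalSet c)) atBot (𝓝 0)) ∧
    ContDiff ℝ ((r + 3 : ℕ) : WithTop ℕ∞) q ∧
    ∀ l : ℕ, 1 ≤ l → l ≤ r + 3 →
      Tendsto (iteratedDeriv l q) atTop (𝓝 0) ∧ Tendsto (iteratedDeriv l q) atBot (𝓝 0) := by
  obtain ⟨h1, h2, h3⟩ := hsol.relaxes_atTop hA1 hA2 hA3 hA4 hA5
  have hA4' : S.FiniteThermostatEnergy ξ₀ fun m ν => -ξ₀' m ν := by
    intro m hm
    obtain ⟨h1, h2, h3⟩ := hA4 m hm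
    exact ⟨h1, h2.neg, by simpa [thermostatEnergy] using h3⟩
  obtain ⟨⟨c, hc, h4⟩, -, h5⟩ := hsol.reverse.relaxes_atTop hA1 hA2 hA3 hA4' hA5
  refine ⟨h1, ⟨c, hc, ?_⟩, h2, fun l hl1 hl => ⟨h3 l hl1 hl, ?_⟩⟩
  · simpa [Function.comp_def] using h4.comp tendsto_neg_atBot_atTop
  · have h6 : iteratedDeriv l q =
        fun t => (-1 : ℝ) ^ l • iteratedDeriv l (fun s => q (-s)) (-t) := by
      ext1 t
      rw [iteratedDeriv_comp_neg, neg_neg, smul_smul, ← mul_pow]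
      simp
    rw [h6]
    simpa using ((h5 l hl1 hl).comp tendsto_neg_atBot_atTop).const_smul ((-1 : ℝ) ^ l)
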